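/- Let $\mathbb K=\mathbb R$ or $\mathbb C$, let $D\subseteq\mathbb K^2$ be open, and let $\mathcal W$ be a 3-web of class $C^n$ on $D$, $n\in\{\infty,\omega\}$: three mutually transversal foliations by curves of class $C^n$, with tangent line fields $T^h,T^v,T^t$. Let $h$ be the projection onto $T^h$ along $T^v$, let $v=\mathrm{id}-h$, and let $j$ be the involution that exchanges $T^h$ and $T^v$ and equals $-\mathrm{id}$ on $T^t$. The Chern connection $\nabla$ is the unique linear connection on $D$ with $\nabla h=0$, $\nabla j=0$ and torsion satisfying $T(hX,vY)=0$. For $p\in D$ let $E_p$ be the space of pre-linearizations at $p$, that is, of symmetric bilinear maps $L_0:T_p\times T_p\to T_p$ such that the connection $\nabla+L_0$ preserves the web at $p$ (for each of the three foliations and each local vector field $X$ tangent to its leaves, $\nabla_XX+L_0(X,X)$ is tangent to the leaf at $p$). A linearization of $\mathcal W$ on an open set $U\subseteq D$ is a $(1,2)$-tensor field $L$ of class $C^n$ on $U$ with $L_q\in E_q$ for all $q\in U$ such that the connection $\nabla^L_XY=\nabla_XY+L(X,Y)$ has zero curvature. Two germs at $p$ of linearizations $L,L'$ are projectively equivalent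 if near $p$ there is a 1-form $\eta$ of class $C^n$ with $\nabla^L_XY=\nabla^{L'}_XY+\eta(X)Y+\eta(Y)X$. Suppose that $\mathcal W$ is parallelizable: near each point of $D$ some local diffeomorphism of class $C^n$ takes $\mathcal W$ to three families of parallel lines, or (equivalently) the curvature of $\nabla$ vanishes on $D$. Then for every $p\in D$: 1. for every $L_0\in E_p$ there is a germ at $p$ of a linearization $L$ with $L_p=L_0$; 2. there are two germs at $p$ of linearizations of $\mathcal W$ that are not projectively equivalent. -/

import Mathlib

open Set Filter Topology
open scoped ContDiff

noncomputable section

namespace PlaneWeb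

/-- The real (`𝕜 = ℝ`) or complex (`𝕜 = ℂ`) plane. It is also its own tangent space at each point. -/
abbrev Plane (𝕜 : Type*) := 𝕜 × 𝕜

/-- Endomorphisms of the tangent space. A field of `(1,1)`-tensors is a map `Plane 𝕜 → End2 𝕜`. -/
abbrev End2 (𝕜 : Type*) [RCLike 𝕜] := Plane 𝕜 →L[𝕜] Plane 𝕜

/-- Bilinear maps `T × T → T` at a point, that is, `(1,2)`-tensors. -/
abbrev Bilin2 (𝕜 : Type*) [RCLike 𝕜] := Plane 𝕜 →L[𝕜] Plane 𝕜 →L[𝕜] Plane 𝕜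

variable {𝕜 : Type*} [RCLike 𝕜]

/-- The field of tangent lines `T` is the tangent distribution of a foliation of class `C^n` of the
open set `D` by curves: locally, the leaves are the level sets of a submersion `f` to the line. -/
def IsFoliation (n : WithTop ℕ∞) (D : Set (Plane 𝕜)) (T : Plane 𝕜 → Submodule 𝕜 (Plane 𝕜)) : Prop :=
  ∀ p ∈ D, ∃ U : Set (Plane 𝕜), IsOpen U ∧ p ∈ U ∧ U ⊆ D ∧ ∃ f : Plane 𝕜 → 𝕜,
    ContDiffOn 𝕜 n f U ∧ ∀ q ∈ U, fderiv 𝕜 f q ≠ 0 ∧ T q = (fderiv 𝕜 f q).ker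

/-- The projection onto the subspace `P` along the subspace `Q`
(set to zero if the two are not complementary). -/
def projAlong (P Q : Submodule 𝕜 (Plane 𝕜)) : End2 𝕜 :=
  open Classical in
  if hPQ : IsCompl P Q then LinearMap.toContinuousLinearMap (P.projection Q hPQ) else 0

/-! ### Linear connections

A linear connection on an open subset of the plane is given by its Christoffel form `Γ`:
`∇_X Y = DY(X) + Γ(X, Y)`. -/

/-- The covariant derivative `(∇_a Y)(q) = DY_q(a) + Γ_q(a, Y(q))`, where `G = Γ_q`. -/
def covDeriv (G : Bilin2 𝕜) (q : Plane 𝕜) (a : Plane 𝕜) (Y : Plane 𝕜 → Plane 𝕜) : Plane 𝕜 :=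
  fderiv 𝕜 Y q a + G a (Y q)

/-- The curvature `R(X, Y) Z = ∇_X ∇_Y Z - ∇_Y ∇_X Z - ∇_[X,Y] Z` of the connection with Christoffel
form `Γ`, for tangent vectors `X, Y, Z` at `q`, in terms of `Γ` and its first derivatives. -/
def curvature (Γ : Plane 𝕜 → Bilin2 𝕜) (q X Y Z : Plane 𝕜) : Plane 𝕜 :=
  fderiv 𝕜 Γ q X Y Z - fderiv 𝕜 Γ q Y X Z + Γ q X (Γ q Y Z) - Γ q Y (Γ q X Z)

/-- The connection is flat on `U`: its curvature vanishes at every point of `U`. -/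
def IsFlatOn (U : Set (Plane 𝕜)) (Γ : Plane 𝕜 → Bilin2 𝕜) : Prop :=
  ∀ q ∈ U, ∀ X Y Z : Plane 𝕜, curvature Γ q X Y Z = 0

/-- The torsion `T(X, Y) = ∇_X Y - ∇_Y X - [X, Y]` of the connection with Christoffel form `Γ`
at `q`, where `G = Γ_q`. -/
def torsion (G : Bilin2 𝕜) (X Y : Plane 𝕜) : Plane 𝕜 := G X Y - G Y X

/-- The covariant derivative `(∇_a A) b = ∇_a (A b) - A (∇_a b)` of a field `A` of endomorphisms
at `q`, where `G = Γ_q`. -/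
def covDerivEnd (G : Bilin2 𝕜) (A : Plane 𝕜 → End2 𝕜) (q a b : Plane 𝕜) : Plane 𝕜 :=
  fderiv 𝕜 A q a b + G a (A q b) - A q (G a b)

/-- Two connections are projectively related on `U`:
`∇_X Y = ∇'_X Y + η(X) Y + η(Y) X` for a 1-form `η` of class `C^n` on `U`. -/
def ProjRelatedOn (n : WithTop ℕ∞) (U : Set (Plane 𝕜)) (Γ Γ' : Plane 𝕜 → Bilin2 𝕜) : Prop :=
  ∃ η : Plane 𝕜 → (Plane 𝕜 →L[𝕜] 𝕜), ContDiffOn 𝕜 n η U ∧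
    ∀ q ∈ U, ∀ X Y : Plane 𝕜, Γ q X Y = Γ' q X Y + η q X • Y + η q Y • X

/-- The bracket form of two fields of endomorphisms: `(a, b) ↦ [A a, B b](q)`, the Lie bracket
of the vector fields `A a` and `B b` for constant `a` and `b`. -/
def bracketForm (A B : Plane 𝕜 → End2 𝕜) (q : Plane 𝕜) : Bilin2 𝕜 :=
  (fderiv 𝕜 B q).bilinearComp (A q) (ContinuousLinearMap.id 𝕜 (Plane 𝕜))
    - ((fderiv 𝕜 A q).bilinearComp (B q) (ContinuousLinearMap.id 𝕜 (Plane 𝕜))).flip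

end PlaneWeb

open PlaneWeb

/-- A 3-web of class `C^n` on the open subset `D` of the plane: three mutually transversal
foliations, the horizontal (`0`), the vertical (`1`) and the transversal (`2`) one.
`tang i q` is the tangent line at `q` of the `i`-th foliation. -/
structure ThreeWeb (𝕜 : Type*) [RCLike 𝕜] (n : WithTop ℕ∞) (D : Set (Plane 𝕜)) where
  tang : Fin 3 → Plane 𝕜 → Submodule 𝕜 (Plane 𝕜)
  foliation : ∀ i, IsFoliation n D (tang i)
  transversal : ∀ i k, i ≠ k → ∀ q ∈ D, IsCompl (tang i q) (tang k q)

namespace ThreeWeb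

variable {𝕜 : Type*} [RCLike 𝕜] {n : WithTop ℕ∞} {D : Set (Plane 𝕜)} (W : ThreeWeb 𝕜 n D)

/-- The projection `h` onto the horizontal line along the vertical line. -/
def h (q : Plane 𝕜) : End2 𝕜 := projAlong (W.tang 0 q) (W.tang 1 q)

/-- The projection `v = id - h` onto the vertical line along the horizontal line. -/
def v (q : Plane 𝕜) : End2 𝕜 := ContinuousLinearMap.id 𝕜 (Plane 𝕜) - W.h q

/-- The involution `j` that exchanges the horizontal and the vertical line and is `-id` on the
transversal line: it is given on the horizontal line by the projection to the vertical line along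
the transversal one, and on the vertical line by the projection to the horizontal line along the
transversal one. -/
def j (q : Plane 𝕜) : End2 𝕜 :=
  projAlong (W.tang 1 q) (W.tang 2 q) ∘L W.h q + projAlong (W.tang 0 q) (W.tang 2 q) ∘L W.v q

/-- The Christoffel form of the Chern connection
`∇_X Y = v[hX, vY] + h[vX, hY] + jv[hX, jhY] + jh[vX, jvY]`. -/
def chern (q : Plane 𝕜) : Bilin2 𝕜 :=
  ContinuousLinearMap.compL 𝕜 (Plane 𝕜) (Plane 𝕜) (Plane 𝕜) (W.v q) ∘L bracketForm W.h W.v q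
  + ContinuousLinearMap.compL 𝕜 (Plane 𝕜) (Plane 𝕜) (Plane 𝕜) (W.h q) ∘L bracketForm W.v W.h q
  + ContinuousLinearMap.compL 𝕜 (Plane 𝕜) (Plane 𝕜) (Plane 𝕜) (W.j q ∘L W.v q) ∘L
      bracketForm W.h (fun x => W.j x ∘L W.h x) q
  + ContinuousLinearMap.compL 𝕜 (Plane 𝕜) (Plane 𝕜) (Plane 𝕜) (W.j q ∘L W.h q) ∘L
      bracketForm W.v (fun x => W.j x ∘L W.v x) q

/-- The properties that single out the Chern connection at `q`: `∇h = 0`, `∇j = 0` and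
`T(hX, vY) = 0`. -/
def IsChernAt (q : Plane 𝕜) (G : Bilin2 𝕜) : Prop :=
  (∀ a b, covDerivEnd G W.h q a b = 0) ∧ (∀ a b, covDerivEnd G W.j q a b = 0) ∧
    ∀ a b, torsion G (W.h q a) (W.v q b) = 0

theorem h_apply {q : Plane 𝕜} (hq : q ∈ D) (x : Plane 𝕜) :
    W.h q x = (W.tang 0 q).projection (W.tang 1 q) (W.transversal 0 1 (by decide) q hq) x := by
  simp [h, projAlong, W.transversal 0 1 (by decide) q hq]

/-- `h² = h` -/
theorem h_h {q : Plane 𝕜} (hq : q ∈ D) (x : Plane 𝕜) : W.h q (W.h q x) = W.h q x := by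
  rw [W.h_apply hq, W.h_apply hq]
  exact Submodule.projection_apply_of_mem_left _ (Submodule.projection_apply_mem _ _)

theorem h_mem {q : Plane 𝕜} (hq : q ∈ D) (x : Plane 𝕜) : W.h q x ∈ W.tang 0 q := by
  rw [W.h_apply hq]
  exact Submodule.projection_apply_mem _ _

theorem h_eq_zero_iff {q : Plane 𝕜} (hq : q ∈ D) (x : Plane 𝕜) :
    W.h q x = 0 ↔ x ∈ W.tang 1 q := by
  rw [W.h_apply hq]
  exact Submodule.projection_apply_eq_zero_iff _

theorem h_of_mem {q : Plane 𝕜} (hq : q ∈ D) {x : Plane 𝕜} (hx : x ∈ W.tang 0 q) :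
    W.h q x = x := by
  rw [W.h_apply hq]
  exact Submodule.projection_apply_of_mem_left _ hx

theorem v_apply (q x : Plane 𝕜) : W.v q x = x - W.h q x := by simp [v]

theorem v_mem {q : Plane 𝕜} (hq : q ∈ D) (x : Plane 𝕜) : W.v q x ∈ W.tang 1 q := by
  rw [← W.h_eq_zero_iff hq, W.v_apply, map_sub, W.h_h hq, sub_self]

theorem j_apply (q x : Plane 𝕜) : W.j q x =
    projAlong (W.tang 1 q) (W.tang 2 q) (W.h q x) +
      projAlong (W.tang 0 q) (W.tang 2 q) (W.v q x) := rfl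

theorem projAlong_apply {P Q : Submodule 𝕜 (Plane 𝕜)} (hPQ : IsCompl P Q) (x : Plane 𝕜) :
    projAlong P Q x = P.projection Q hPQ x := by
  simp [projAlong, hPQ]

theorem projAlong_mem (P Q : Submodule 𝕜 (Plane 𝕜)) (x : Plane 𝕜) : projAlong P Q x ∈ P := by
  by_cases hPQ : IsCompl P Q
  · rw [projAlong_apply hPQ]
    exact Submodule.projection_apply_mem _ _
  · simp [projAlong, hPQ]

theorem sub_projAlong_mem {P Q : Submodule 𝕜 (Plane 𝕜)} (hPQ : IsCompl P Q) (x : Plane 𝕜) :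
    x - projAlong P Q x ∈ Q := by
  rw [projAlong_apply hPQ, ← Submodule.projection_apply_eq_zero_iff hPQ, map_sub,
    Submodule.projection_apply_of_mem_left hPQ (Submodule.projection_apply_mem hPQ x), sub_self]

theorem projAlong_unique {P Q : Submodule 𝕜 (Plane 𝕜)} (hPQ : IsCompl P Q) {x y : Plane 𝕜}
    (hy : y ∈ P) (hxy : x - y ∈ Q) : projAlong P Q x = y := by
  have h1 := (Submodule.projection_apply_eq_zero_iff hPQ).2 hxy
  rw [map_sub, Submodule.projection_apply_of_mem_left hPQ hy, sub_eq_zero] at h1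
  rw [projAlong_apply hPQ, h1]

theorem j_of_mem_zero {q : Plane 𝕜} (hq : q ∈ D) {x : Plane 𝕜} (hx : x ∈ W.tang 0 q) :
    W.j q x ∈ W.tang 1 q ∧ x - W.j q x ∈ W.tang 2 q := by
  have e : W.j q x = projAlong (W.tang 1 q) (W.tang 2 q) x := by
    simp [j, W.v_apply, W.h_of_mem hq hx]
  rw [e]
  exact ⟨projAlong_mem _ _ _, sub_projAlong_mem (W.transversal 1 2 (by decide) q hq) _⟩

theorem j_of_mem_one {q : Plane 𝕜} (hq : q ∈ D) {x : Plane 𝕜} (hx : x ∈ W.tang 1 q) :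
    W.j q x ∈ W.tang 0 q ∧ x - W.j q x ∈ W.tang 2 q := by
  have e : W.j q x = projAlong (W.tang 0 q) (W.tang 2 q) x := by
    simp [j, W.v_apply, (W.h_eq_zero_iff hq x).2 hx]
  rw [e]
  exact ⟨projAlong_mem _ _ _, sub_projAlong_mem (W.transversal 0 2 (by decide) q hq) _⟩

/-- `j² = id` -/
theorem j_j {q : Plane 𝕜} (hq : q ∈ D) (x : Plane 𝕜) : W.j q (W.j q x) = x := by
  have h0 : ∀ y ∈ W.tang 0 q, W.j q (W.j q y) = y := by
    intro y hy
    obtain ⟨m1, m2⟩ := W.j_of_mem_zero hq hy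
    have e : W.j q (W.j q y) = projAlong (W.tang 0 q) (W.tang 2 q) (W.j q y) := by
      rw [W.j_apply q (W.j q y), W.v_apply, (W.h_eq_zero_iff hq _).2 m1]
      simp
    rw [e]
    refine projAlong_unique (W.transversal 0 2 (by decide) q hq) hy ?_
    rw [← neg_sub]
    exact Submodule.neg_mem _ m2
  have h1 : ∀ y ∈ W.tang 1 q, W.j q (W.j q y) = y := by
    intro y hy
    obtain ⟨m1, m2⟩ := W.j_of_mem_one hq hy
    have e : W.j q (W.j q y) = projAlong (W.tang 1 q) (W.tang 2 q) (W.j q y) := by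
      rw [W.j_apply q (W.j q y), W.v_apply, W.h_of_mem hq m1]
      simp
    rw [e]
    refine projAlong_unique (W.transversal 1 2 (by decide) q hq) hy ?_
    rw [← neg_sub]
    exact Submodule.neg_mem _ m2
  have hx : x = W.h q x + W.v q x := by rw [W.v_apply]; abel
  conv_lhs => rw [hx]
  rw [map_add, map_add, h0 _ (W.h_mem hq x), h1 _ (W.v_mem hq x), ← hx]

/-- `jh = vj` -/
theorem j_h {q : Plane 𝕜} (hq : q ∈ D) (x : Plane 𝕜) : W.j q (W.h q x) = W.v q (W.j q x) := by
  have hx : x = W.h q x + W.v q x := by rw [W.v_apply]; abel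
  have m0 := (W.j_of_mem_zero hq (W.h_mem hq x)).1
  have m1 := (W.j_of_mem_one hq (W.v_mem hq x)).1
  conv_rhs => rw [hx]
  rw [map_add, map_add, W.v_apply, W.v_apply, (W.h_eq_zero_iff hq _).2 m0, W.h_of_mem hq m1]
  simp

/-- `Ker (j + id)` is the transversal line. -/
theorem j_eq_neg_iff {q : Plane 𝕜} (hq : q ∈ D) (x : Plane 𝕜) :
    W.j q x = -x ↔ x ∈ W.tang 2 q := by
  have hx : x = W.h q x + W.v q x := by rw [W.v_apply]; abel
  obtain ⟨m0, n0⟩ := W.j_of_mem_zero hq (W.h_mem hq x)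
  obtain ⟨m1, n1⟩ := W.j_of_mem_one hq (W.v_mem hq x)
  constructor
  · intro hj
    have e : x - W.j q x ∈ W.tang 2 q := by
      have := Submodule.add_mem _ n0 n1
      have e2 : W.h q x - W.j q (W.h q x) + (W.v q x - W.j q (W.v q x)) = x - W.j q x := by
        conv_rhs => rw [hx, map_add]
        abel
      rwa [e2] at this
    rw [hj, sub_neg_eq_add, ← two_smul 𝕜] at e
    exact (Submodule.smul_mem_iff _ two_ne_zero).1 e
  · intro ht
    have e : x + W.j q x ∈ W.tang 2 q := by
      have h1 : x - W.j q x ∈ W.tang 2 q := by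
        have := Submodule.add_mem _ n0 n1
        have e2 : W.h q x - W.j q (W.h q x) + (W.v q x - W.j q (W.v q x)) = x - W.j q x := by
          conv_rhs => rw [hx, map_add]
          abel
        rwa [e2] at this
      have h2 := Submodule.sub_mem _ (Submodule.add_mem _ ht ht) h1
      have e2 : x + x - (x - W.j q x) = x + W.j q x := by abel
      rwa [e2] at h2
    -- the horizontal part `u` of `x` satisfies `ju = -vx`
    have h2 : W.j q (W.h q x) + W.v q x ∈ W.tang 2 q := by
      have h3 := Submodule.sub_mem _ ht n0
      have e3 : x - (W.h q x - W.j q (W.h q x)) = W.j q (W.h q x) + W.v q x := by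
        rw [W.v_apply]; abel
      rwa [e3] at h3
    have h3 : W.j q (W.h q x) + W.v q x = 0 :=
      Submodule.disjoint_def.1 (W.transversal 1 2 (by decide) q hq).disjoint _
        (Submodule.add_mem _ m0 (W.v_mem hq x)) h2
    have h4 : W.h q x + W.j q (W.v q x) = 0 := by
      have := congrArg (W.j q) h3
      rwa [map_add, W.j_j hq, map_zero] at this
    have h5 : W.j q x + x = 0 := by
      calc W.j q x + x = W.j q (W.h q x + W.v q x) + (W.h q x + W.v q x) := by rw [← hx]
        _ = (W.j q (W.h q x) + W.v q x) + (W.h q x + W.j q (W.v q x)) := by rw [map_add]; abel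
        _ = 0 := by rw [h3, h4, add_zero]
    exact eq_neg_of_add_eq_zero_left h5

/-- The projection along the kernels of two 1-forms, in coordinates. -/
theorem projAlong_ker {α β : Plane 𝕜 →L[𝕜] 𝕜}
    (hc : IsCompl (α : Plane 𝕜 →ₗ[𝕜] 𝕜).ker (β : Plane 𝕜 →ₗ[𝕜] 𝕜).ker) (hα : α ≠ 0) :
    β (α (0, 1), -α (1, 0)) ≠ 0 ∧
    projAlong (α : Plane 𝕜 →ₗ[𝕜] 𝕜).ker (β : Plane 𝕜 →ₗ[𝕜] 𝕜).ker =
      ((β (α (0, 1), -α (1, 0)))⁻¹ • β).smulRight ((α (0, 1), -α (1, 0)) : Plane 𝕜) := by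
  have key : ∀ x : Plane 𝕜, α x = x.1 * α (1, 0) + x.2 * α (0, 1) := by
    intro x
    have : x = x.1 • ((1, 0) : Plane 𝕜) + x.2 • ((0, 1) : Plane 𝕜) := by
      ext <;> simp
    conv_lhs => rw [this]
    rw [map_add, map_smul, map_smul, smul_eq_mul, smul_eq_mul]
  have mem : ((α (0, 1), -α (1, 0)) : Plane 𝕜) ∈ (α : Plane 𝕜 →ₗ[𝕜] 𝕜).ker := by
    rw [LinearMap.mem_ker]
    change α _ = 0
    rw [key]; ring
  have hne : β (α (0, 1), -α (1, 0)) ≠ 0 := by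
    intro h0
    have := Submodule.disjoint_def.1 hc.disjoint _ mem (LinearMap.mem_ker.2 h0)
    rw [Prod.ext_iff] at this
    simp only [Prod.fst_zero, Prod.snd_zero, neg_eq_zero] at this
    apply hα
    refine ContinuousLinearMap.ext fun x => ?_
    rw [key, this.1, this.2]
    simp
  refine ⟨hne, ?_⟩
  refine ContinuousLinearMap.ext fun x => projAlong_unique hc ?_ ?_
  · exact Submodule.smul_mem _ _ mem
  · rw [LinearMap.mem_ker]
    change β _ = 0
    simp only [ContinuousLinearMap.smulRight_apply, _root_.smul_apply, map_sub,
      map_smul, smul_eq_mul]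
    field_simp
    simp

theorem projAlong_tang_differentiableAt (hn : 2 ≤ n) (i k : Fin 3) (hik : i ≠ k) {q : Plane 𝕜}
    (hq : q ∈ D) :
    DifferentiableAt 𝕜 (fun x => projAlong (W.tang i x) (W.tang k x)) q := by
  obtain ⟨U, hU, hqU, hUD, f, hf, hf'⟩ := W.foliation i q hq
  obtain ⟨U', hU', hqU', -, g, hg, hg'⟩ := W.foliation k q hq
  have df : DifferentiableAt 𝕜 (fderiv 𝕜 f) q :=
    ((hf.contDiffAt (hU.mem_nhds hqU)).fderiv_right (m := 1) (by rwa [one_add_one_eq_two])).differentiableAt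
      one_ne_zero
  have dg : DifferentiableAt 𝕜 (fderiv 𝕜 g) q :=
    ((hg.contDiffAt (hU'.mem_nhds hqU')).fderiv_right (m := 1) (by rwa [one_add_one_eq_two])).differentiableAt
      one_ne_zero
  have key : ∀ x ∈ U ∩ U', _ := fun x hx => projAlong_ker (α := fderiv 𝕜 f x) (β := fderiv 𝕜 g x)
    (by
      have := W.transversal i k hik x (hUD hx.1)
      rwa [(hf' x hx.1).2, (hg' x hx.2).2] at this) (hf' x hx.1).1
  have ev : (fun x => projAlong (W.tang i x) (W.tang k x)) =ᶠ[𝓝 q] fun x =>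
      ((fderiv 𝕜 g x (fderiv 𝕜 f x (0, 1), -fderiv 𝕜 f x (1, 0)))⁻¹ • fderiv 𝕜 g x).smulRight
        ((fderiv 𝕜 f x (0, 1), -fderiv 𝕜 f x (1, 0)) : Plane 𝕜) := by
    filter_upwards [hU.mem_nhds hqU, hU'.mem_nhds hqU'] with x hx hx'
    rw [(hf' x hx).2, (hg' x hx').2]
    exact (key x ⟨hx, hx'⟩).2
  refine DifferentiableAt.congr_of_eventuallyEq ?_ ev
  have hX : DifferentiableAt 𝕜
      (fun x => ((fderiv 𝕜 f x (0, 1), -fderiv 𝕜 f x (1, 0)) : Plane 𝕜)) q :=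
    (df.clm_apply (differentiableAt_const _)).prodMk (df.clm_apply (differentiableAt_const _)).neg
  have hs : DifferentiableAt 𝕜 (fun x =>
      (fderiv 𝕜 g x (fderiv 𝕜 f x (0, 1), -fderiv 𝕜 f x (1, 0)))⁻¹ • fderiv 𝕜 g x) q :=
    ((dg.clm_apply hX).inv (key q ⟨hqU, hqU'⟩).1).smul dg
  have hs' : DifferentiableAt 𝕜 (fun x => ContinuousLinearMap.smulRightL 𝕜 (Plane 𝕜) (Plane 𝕜)
      ((fderiv 𝕜 g x (fderiv 𝕜 f x (0, 1), -fderiv 𝕜 f x (1, 0)))⁻¹ • fderiv 𝕜 g x)) q :=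
    DifferentiableAt.comp (g := fun c : Plane 𝕜 →L[𝕜] 𝕜 =>
      ContinuousLinearMap.smulRightL 𝕜 (Plane 𝕜) (Plane 𝕜) c) q
      (ContinuousLinearMap.differentiableAt _) hs
  exact hs'.clm_apply hX

theorem h_differentiableAt (hn : 2 ≤ n) {q : Plane 𝕜} (hq : q ∈ D) : DifferentiableAt 𝕜 W.h q :=
  W.projAlong_tang_differentiableAt hn 0 1 (by decide) hq

theorem v_differentiableAt (hn : 2 ≤ n) {q : Plane 𝕜} (hq : q ∈ D) : DifferentiableAt 𝕜 W.v q :=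
  (differentiableAt_const _).sub (W.h_differentiableAt hn hq)

theorem j_differentiableAt (hn : 2 ≤ n) {q : Plane 𝕜} (hq : q ∈ D) : DifferentiableAt 𝕜 W.j q :=
  ((W.projAlong_tang_differentiableAt hn 1 2 (by decide) hq).clm_comp
    (W.h_differentiableAt hn hq)).add
    ((W.projAlong_tang_differentiableAt hn 0 2 (by decide) hq).clm_comp
      (W.v_differentiableAt hn hq))

/-- The product rule for fields of endomorphisms. -/
theorem fderiv_comp_apply {A B : Plane 𝕜 → End2 𝕜} {q : Plane 𝕜} (hA : DifferentiableAt 𝕜 A q)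
    (hB : DifferentiableAt 𝕜 B q) (a b : Plane 𝕜) :
    fderiv 𝕜 (fun x => A x ∘L B x) q a b
      = fderiv 𝕜 A q a (B q b) + A q (fderiv 𝕜 B q a b) := by
  rw [fderiv_clm_comp hA hB]
  simp [add_comm]

theorem h_j {q : Plane 𝕜} (hq : q ∈ D) (x : Plane 𝕜) :
    W.h q (W.j q x) = W.j q x - W.j q (W.h q x) := by
  rw [W.j_h hq, W.v_apply]; abel

theorem fderiv_h_h (hn : 2 ≤ n) (hD : IsOpen D) {q : Plane 𝕜} (hq : q ∈ D) (w b : Plane 𝕜) :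
    fderiv 𝕜 W.h q w (W.h q b) = fderiv 𝕜 W.h q w b - W.h q (fderiv 𝕜 W.h q w b) := by
  have hh := W.h_differentiableAt hn hq
  have ev : (fun x => W.h x ∘L W.h x) =ᶠ[𝓝 q] W.h := by
    filter_upwards [hD.mem_nhds hq] with x hx
    exact ContinuousLinearMap.ext fun y => W.h_h hx y
  have := fderiv_comp_apply hh hh w b
  rw [ev.fderiv_eq] at this
  exact eq_sub_of_add_eq this.symm

theorem fderiv_j_j (hn : 2 ≤ n) (hD : IsOpen D) {q : Plane 𝕜} (hq : q ∈ D) (w b : Plane 𝕜) :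
    fderiv 𝕜 W.j q w (W.j q b) = -W.j q (fderiv 𝕜 W.j q w b) := by
  have hj := W.j_differentiableAt hn hq
  have ev : (fun x => W.j x ∘L W.j x) =ᶠ[𝓝 q] fun _ => ContinuousLinearMap.id 𝕜 (Plane 𝕜) := by
    filter_upwards [hD.mem_nhds hq] with x hx
    exact ContinuousLinearMap.ext fun y => W.j_j hx y
  have := fderiv_comp_apply hj hj w b
  rw [ev.fderiv_eq, fderiv_fun_const] at this
  exact eq_neg_of_add_eq_zero_left this.symm

theorem fderiv_v (q w b : Plane 𝕜) : fderiv 𝕜 W.v q w b = -fderiv 𝕜 W.h q w b := by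
  have : W.v = fun x => ContinuousLinearMap.id 𝕜 (Plane 𝕜) - W.h x := rfl
  rw [this, fderiv_const_sub]
  rfl

theorem fderiv_h_j (hn : 2 ≤ n) (hD : IsOpen D) {q : Plane 𝕜} (hq : q ∈ D) (w b : Plane 𝕜) :
    fderiv 𝕜 W.h q w (W.j q b) = fderiv 𝕜 W.j q w b - W.h q (fderiv 𝕜 W.j q w b)
      - W.j q (fderiv 𝕜 W.h q w b) - fderiv 𝕜 W.j q w (W.h q b) := by
  have hh := W.h_differentiableAt hn hq
  have hj := W.j_differentiableAt hn hq
  have ev : (fun x => W.j x ∘L W.h x) =ᶠ[𝓝 q] fun x => W.v x ∘L W.j x := by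
    filter_upwards [hD.mem_nhds hq] with x hx
    exact ContinuousLinearMap.ext fun y => W.j_h hx y
  have := fderiv_comp_apply hj hh w b
  rw [ev.fderiv_eq, fderiv_comp_apply (W.v_differentiableAt hn hq) hj, W.fderiv_v, W.v_apply] at this
  rw [← sub_eq_zero] at this ⊢
  rw [← neg_eq_zero, ← this]
  abel

theorem chern_apply (q a b : Plane 𝕜) : W.chern q a b =
    W.v q (fderiv 𝕜 W.v q (W.h q a) b - fderiv 𝕜 W.h q (W.v q b) a)
    + W.h q (fderiv 𝕜 W.h q (W.v q a) b - fderiv 𝕜 W.v q (W.h q b) a)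
    + W.j q (W.v q (fderiv 𝕜 (fun x => W.j x ∘L W.h x) q (W.h q a) b
        - fderiv 𝕜 W.h q (W.j q (W.h q b)) a))
    + W.j q (W.h q (fderiv 𝕜 (fun x => W.j x ∘L W.v x) q (W.v q a) b
        - fderiv 𝕜 W.v q (W.j q (W.v q b)) a)) := rfl

/-- `chern` has the defining properties of the Chern connection. -/
theorem chern_isChernAt (hn : 2 ≤ n) (hD : IsOpen D) {q : Plane 𝕜} (hq : q ∈ D) :
    W.IsChernAt q (W.chern q) := by
  have hh := W.h_differentiableAt hn hq
  have hj := W.j_differentiableAt hn hq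
  have hv := W.v_differentiableAt hn hq
  refine ⟨fun a b => ?_, fun a b => ?_, fun a b => ?_⟩ <;>
  simp only [covDerivEnd, torsion, W.chern_apply, fderiv_comp_apply hj hh, fderiv_comp_apply hj hv,
    W.fderiv_v, W.v_apply, map_sub, map_add, map_neg, W.h_h hq, W.j_j hq, W.h_j hq,
    W.fderiv_h_h hn hD hq, W.fderiv_h_j hn hD hq, W.fderiv_j_j hn hD hq,
    _root_.sub_apply] <;> abel

/-- The Chern connection is unique. -/
theorem IsChernAt.unique {q : Plane 𝕜} (hq : q ∈ D) {G G' : Bilin2 𝕜} (hG : W.IsChernAt q G)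
    (hG' : W.IsChernAt q G') : G = G' := by
  obtain ⟨g1, g2, g3⟩ := hG
  obtain ⟨g1', g2', g3'⟩ := hG'
  simp only [covDerivEnd, torsion] at *
  set S := G - G' with hS
  have s1 : ∀ a b, S a (W.h q b) = W.h q (S a b) := by
    intro a b
    have := (g1 a b).trans (g1' a b).symm
    simp only [hS, _root_.sub_apply, map_sub]
    rw [← sub_eq_zero] at this ⊢
    rw [← this]; abel
  have s2 : ∀ a b, S a (W.j q b) = W.j q (S a b) := by
    intro a b
    have := (g2 a b).trans (g2' a b).symm
    simp only [hS, _root_.sub_apply, map_sub]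
    rw [← sub_eq_zero] at this ⊢
    rw [← this]; abel
  have s3 : ∀ a b, S (W.h q a) (W.v q b) = S (W.v q b) (W.h q a) := by
    intro a b
    have := (g3 a b).trans (g3' a b).symm
    simp only [hS, _root_.sub_apply]
    rw [← sub_eq_zero] at this ⊢
    rw [← this]; abel
  have z1 : ∀ a b, S (W.h q a) (W.v q b) = 0 := by
    intro a b
    have e := congrArg (W.h q) (s3 a b)
    rw [← s1, W.v_apply, map_sub, W.h_h hq, sub_self, map_zero, ← W.v_apply, s1, W.h_h hq, ← s1,
      ← s3] at e
    exact e.symm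
  have z2 : ∀ a b, S (W.v q b) (W.h q a) = 0 := fun a b => by rw [← s3, z1]
  have z3 : ∀ a b, S (W.h q a) (W.h q b) = 0 := by
    intro a b
    rw [← W.j_j hq (W.h q b), W.j_h hq, s2, z1, map_zero]
  have z4 : ∀ a b, S (W.v q a) (W.v q b) = 0 := by
    intro a b
    have : W.v q b = W.j q (W.h q (W.j q b)) := by rw [W.j_h hq, W.j_j hq]
    rw [this, s2, z2, map_zero]
  have z : S = 0 := by
    refine ContinuousLinearMap.ext fun a => ContinuousLinearMap.ext fun b => ?_
    have ha : a = W.h q a + W.v q a := by rw [W.v_apply]; abel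
    have hb : b = W.h q b + W.v q b := by rw [W.v_apply]; abel
    rw [ha, hb, map_add, map_add, _root_.add_apply, _root_.add_apply, z1, z2, z3, z4]
    simp
  exact sub_eq_zero.1 z

/-- A connection with Christoffel form `G` at `q` leaves the `i`-th foliation auto-parallel at `q`:
`∇_X X` is tangent to the leaf for each local vector field `X` tangent to the leaves. -/
def AutoparallelAt (i : Fin 3) (q : Plane 𝕜) (G : Bilin2 𝕜) : Prop :=
  ∀ X : Plane 𝕜 → Plane 𝕜, DifferentiableAt 𝕜 X q → (∀ᶠ x in 𝓝 q, X x ∈ W.tang i x) →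
    covDeriv G q (X q) X ∈ W.tang i q

/-- `L₀ ∈ E_q`: the symmetric `(1,2)`-tensor `L₀` at `q` is a pre-linearization at `q`, that is,
`∇ + L₀`, with `∇` the Chern connection, preserves the web at `q`. -/
def IsPrelinearizationAt (q : Plane 𝕜) (L₀ : Bilin2 𝕜) : Prop :=
  (∀ a b, L₀ a b = L₀ b a) ∧ ∀ i, W.AutoparallelAt i q (W.chern q + L₀)

/-- The fibre `E_q` of the bundle of pre-linearizations. -/
def E (q : Plane 𝕜) : Set (Bilin2 𝕜) := {L₀ | W.IsPrelinearizationAt q L₀}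

/-- The connection `∇^L = ∇ + L`. -/
def connection (L : Plane 𝕜 → Bilin2 𝕜) (q : Plane 𝕜) : Bilin2 𝕜 := W.chern q + L q

/-- The tensor field `L`, of class `C^n` on `U`, is a linearization of the web on `U`: a section
over `U` of the bundle of pre-linearizations such that `∇^L` is flat. -/
def IsLinearizationOn (U : Set (Plane 𝕜)) (L : Plane 𝕜 → Bilin2 𝕜) : Prop :=
  ContDiffOn 𝕜 n L U ∧ (∀ q ∈ U, L q ∈ W.E q) ∧ IsFlatOn U (W.connection L)

/-- `L` represents a germ at `p` of linearizations of the web. -/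
def IsLinearizationGerm (p : Plane 𝕜) (L : Plane 𝕜 → Bilin2 𝕜) : Prop :=
  ∃ U : Set (Plane 𝕜), IsOpen U ∧ p ∈ U ∧ U ⊆ D ∧ W.IsLinearizationOn U L

/-- The germs at `p` of `L` and `L'` are projectively equivalent: `∇^L` and `∇^L'` are projectively
related on a neighbourhood of `p`. -/
def ProjEquivGerm (p : Plane 𝕜) (L L' : Plane 𝕜 → Bilin2 𝕜) : Prop :=
  ∃ U : Set (Plane 𝕜), IsOpen U ∧ p ∈ U ∧ U ⊆ D ∧
    ProjRelatedOn n U (W.connection L) (W.connection L')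

/-- The web is parallelizable: near each point of `D`, a local diffeomorphism of class `C^n` takes
its three foliations to three foliations by parallel lines (with directions `ℓ i`). -/
def IsParallelizable : Prop :=
  ∀ p ∈ D, ∃ φ : OpenPartialHomeomorph (Plane 𝕜) (Plane 𝕜), p ∈ φ.source ∧ φ.source ⊆ D ∧
    ContDiffOn 𝕜 n φ φ.source ∧ ContDiffOn 𝕜 n φ.symm φ.target ∧
    ∃ ℓ : Fin 3 → Submodule 𝕜 (Plane 𝕜), ∀ i, ∀ q ∈ φ.source,
      (W.tang i q).map (fderiv 𝕜 φ q : Plane 𝕜 →ₗ[𝕜] Plane 𝕜) = ℓ i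

end ThreeWeb

end

open PlaneWeb

/-! Both forms of the hypothesis give functions `x`, `y` near `p` such that the web consists of the
level lines of `y`, `x` and `x + y` (`IsParallelChart`). From a parallelizing diffeomorphism they
are obtained as linear functions of it. If instead the Chern connection `∇` is flat, let `f` be
constant on the transversal leaves. Since `h` and `j` are parallel, `φ = df ∘ h` and `φ = df ∘ v`
satisfy `∇φ = l ⊗ φ` with the same `l`. Flatness makes `l` closed, so `l = dw` locally. The forms
`e^{-w} φ` are then parallel, hence closed because `∇` has no torsion, and their primitives are `x`
and `y`.

In such a chart `dx` and `dy` are parallel (`chern_eq`), so `∇` is the coordinate connection. The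
three tangency conditions leave three of the six coordinates of a symmetric tensor: with `e₁, e₂`
dual to `dx, dy`, the elements of `E_p` are the sums of `t (dx² e₁ - dy² e₂)` and `symId σ`
(`exists_eq_of_mem_E`). For constant `t`, the connection `∇ + webTensor t` has a parallel coframe
proportional to `e^{tx} dx`, `e^{-ty} dy`, so it is flat. Adding `symId σ` keeps the curvature if
`σ` has covariant derivative `σ ⊗ σ` (`curvature_add_symId`). This holds for `σ = φ / u` with `φ`
parallel and `du = -φ`. As `φ_p` is arbitrary and `u(p)` may be taken to be `1`, every initial value
occurs (`exists_linearization`).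

A projective change alters only the `symId` part at `p`, so linearizations with different `t` are
inequivalent. -/

/-! ### Primitives of closed 1-forms, smooth or analytic. -/

section Poincare

open MeasureTheory

variable {𝕜 : Type*} [RCLike 𝕜] {E : Type*} [NormedAddCommGroup E] [NormedSpace 𝕜 E]

/-- A function whose derivative has a power series expansion around `x` has one as well:
the series is integrated term by term along rays. -/
theorem HasFPowerSeriesOnBall.analyticAt_of_hasFDerivAt {u : E → 𝕜} {l : E → E →L[𝕜] 𝕜} {x : E}
    {p : FormalMultilinearSeries 𝕜 E (E →L[𝕜] 𝕜)} {r : ENNReal}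
    (hl : HasFPowerSeriesOnBall l p x r)
    (hu : ∀ y ∈ Metric.eball x r, HasFDerivAt u (l y) y) : AnalyticAt 𝕜 u x := by
  -- The factor is `∫₀¹ sⁿ ds = 1/(n + 1)`, from integrating the term of degree `n` along a ray.
  let q : FormalMultilinearSeries 𝕜 E (E →L[𝕜] 𝕜) := fun n => ((n + 1 : ℕ) : 𝕜)⁻¹ • p n
  have hq : ∀ n, ‖q n‖ ≤ ‖p n‖ := by
    intro n
    refine ContinuousMultilinearMap.opNorm_le_bound (p n).opNorm_nonneg fun m => ?_
    change ‖((n + 1 : ℕ) : 𝕜)⁻¹ • p n m‖ ≤ _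
    rw [norm_smul, norm_inv, RCLike.norm_natCast]
    exact (mul_le_of_le_one_left (norm_nonneg _)
      (inv_le_one_of_one_le₀ (by norm_cast; omega))).trans ((p n).le_opNorm m)
  have hrad : r ≤ q.radius := hl.r_le.trans (FormalMultilinearSeries.radius_le_of_le hq)
  have hqsum : HasFPowerSeriesOnBall (fun y => q.sum (y - x)) q x r := by
    have := (q.hasFPowerSeriesOnBall (hl.r_pos.trans_le hrad)).comp_sub x
    rw [zero_add] at this
    exact this.mono hl.r_pos hrad
  have main : ∀ y ∈ Metric.eball x r, u y = u x + q.sum (y - x) (y - x) := by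
    intro y hy
    set z := y - x with hz
    have hzr : z ∈ Metric.eball (0 : E) r := by
      simpa [hz, edist_eq_enorm_sub] using hy
    have hsz : ∀ s ∈ Icc (0 : ℝ) 1, (s : 𝕜) • z ∈ Metric.eball (0 : E) r := by
      intro s hs
      rw [Metric.mem_eball, edist_zero_right] at hzr ⊢
      refine lt_of_le_of_lt ?_ hzr
      rw [enorm_le_iff_norm_le, norm_smul, RCLike.norm_ofReal, abs_of_nonneg hs.1]
      exact mul_le_of_le_one_left (norm_nonneg _) hs.2
    have hder : ∀ s ∈ Icc (0 : ℝ) 1,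
        HasDerivAt (fun s : ℝ => u (x + (s : 𝕜) • z)) (l (x + (s : 𝕜) • z) z) s := by
      intro s hs
      have hmem : x + (s : 𝕜) • z ∈ Metric.eball x r := by
        simpa [edist_eq_enorm_sub] using hsz s hs
      have h1 : HasDerivAt (fun k : 𝕜 => x + k • z) z (s : 𝕜) := by
        simpa using ((hasDerivAt_id (s : 𝕜)).smul_const z).const_add x
      have h2 := (hu _ hmem).comp_hasDerivAt (s : 𝕜) h1
      have h3 : HasDerivAt (fun s : ℝ => (s : 𝕜)) 1 s := by
        simpa using (RCLike.ofRealCLM (K := 𝕜)).hasDerivAt (x := s)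
      have h4 := HasDerivAt.scomp (𝕜 := ℝ) (𝕜' := 𝕜) s h2 h3
      rwa [one_smul] at h4
    have hnorm : Summable fun n => ‖p n‖ * ‖z‖ ^ n := by
      refine p.summable_norm_mul_pow (r := ‖z‖₊) (lt_of_lt_of_le ?_ hl.r_le)
      simpa [enorm_eq_nnnorm] using hzr
    have hterm : ∀ (n : ℕ) (s : ℝ), (p n fun _ => (s : 𝕜) • z) z
        = (s : 𝕜) ^ n * (p n fun _ => z) z := by
      intro n s
      rw [(p n).map_smul_univ]
      simp
    have hsum : ∀ s ∈ Icc (0 : ℝ) 1,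
        HasSum (fun n => (s : 𝕜) ^ n * (p n fun _ => z) z) (l (x + (s : 𝕜) • z) z) := by
      intro s hs
      have := (ContinuousLinearMap.apply 𝕜 𝕜 z).hasSum (hl.hasSum (hsz s hs))
      simpa [Function.comp_def, hterm] using this
    have hint : HasSum (fun n => ∫ s in (0 : ℝ)..1, (s : 𝕜) ^ n * (p n fun _ => z) z)
        (∫ s in (0 : ℝ)..1, l (x + (s : 𝕜) • z) z) := by
      refine intervalIntegral.hasSum_integral_of_dominated_convergence
        (fun n _ => ‖p n‖ * ‖z‖ ^ n * ‖z‖) (fun n => ?_) (fun n => ?_) ?_ ?_ ?_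
      · exact Continuous.aestronglyMeasurable (by fun_prop)
      · refine Eventually.of_forall fun s hs => ?_
        rw [uIoc_of_le zero_le_one] at hs
        rw [norm_mul, norm_pow, RCLike.norm_ofReal, abs_of_nonneg hs.1.le]
        refine (mul_le_of_le_one_left (norm_nonneg _) (pow_le_one₀ hs.1.le hs.2)).trans ?_
        refine (ContinuousLinearMap.le_opNorm _ _).trans ?_
        refine mul_le_mul_of_nonneg_right ?_ (norm_nonneg _)
        simpa using (p n).le_opNorm fun _ => z
      · exact Eventually.of_forall fun s _ => hnorm.mul_right _
      · exact intervalIntegrable_const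
      · refine Eventually.of_forall fun s hs => ?_
        rw [uIoc_of_le zero_le_one] at hs
        exact hsum s ⟨hs.1.le, hs.2⟩
    have hftc : ∫ s in (0 : ℝ)..1, l (x + (s : 𝕜) • z) z = u y - u x := by
      have hcont : ContinuousOn (fun s : ℝ => l (x + (s : 𝕜) • z) z) (uIcc 0 1) := by
        rw [uIcc_of_le zero_le_one]
        have : ContinuousOn l (Metric.eball x r) := hl.continuousOn
        refine ContinuousOn.clm_apply (this.comp (by fun_prop) fun s hs => ?_) continuousOn_const
        simpa [edist_eq_enorm_sub] using hsz s hs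
      rw [intervalIntegral.integral_eq_sub_of_hasDerivAt
        (fun s hs => hder s (by rwa [uIcc_of_le zero_le_one] at hs)) hcont.intervalIntegrable]
      simp [hz]
    have hpow : ∀ n : ℕ, ∫ s in (0 : ℝ)..1, (s : 𝕜) ^ n * (p n fun _ => z) z
        = (q n fun _ => z) z := by
      intro n
      have : ∫ s in (0 : ℝ)..1, (s : 𝕜) ^ n = ((n + 1 : ℕ) : 𝕜)⁻¹ := by
        have h0 := integral_pow (a := 0) (b := 1) n
        have h1 : ∫ s in (0 : ℝ)..1, (s : 𝕜) ^ n = ((∫ s in (0 : ℝ)..1, s ^ n : ℝ) : 𝕜) := by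
          simp only [← RCLike.ofReal_pow]
          exact RCLike.intervalIntegral_ofReal
        rw [h1, h0]
        simp
      rw [intervalIntegral.integral_mul_const, this]
      simp [q]
    have h2 : HasSum (fun n => (q n fun _ => z) z) (q.sum z z) := by
      have := (ContinuousLinearMap.apply 𝕜 𝕜 z).hasSum (hqsum.hasSum hzr)
      simpa [Function.comp_def] using this
    simp only [hpow, hftc] at hint
    have := hint.unique h2
    rw [← this]; ring
  -- `unshift` raises degrees by one: it is the series of `y ↦ u x + q.sum (y - x) (y - x)`.
  have := (hqsum.unshift (z := u x)).analyticAt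
  refine this.congr ?_
  filter_upwards [Metric.eball_mem_nhds x hl.r_pos] with y hy
  exact (main y hy).symm

theorem AnalyticAt.of_hasFDerivAt {u : E → 𝕜} {l : E → E →L[𝕜] 𝕜} {x : E}
    (hl : AnalyticAt 𝕜 l x) (hu : ∀ᶠ y in 𝓝 x, HasFDerivAt u (l y) y) : AnalyticAt 𝕜 u x := by
  obtain ⟨p, r, hp⟩ := hl
  obtain ⟨ε, hε, hε'⟩ := EMetric.mem_nhds_iff.1 hu
  exact (hp.mono (lt_min hp.r_pos hε) (min_le_left _ _)).analyticAt_of_hasFDerivAt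
    fun y hy => hε' (Metric.eball_subset_eball (min_le_right _ _) hy)

/-- A derivative of class `C^n` makes `u` of class `C^{n+1}`. For `n = ω` the criterion also asks
that `u` itself be analytic, which termwise integration provides. -/
theorem ContDiffOn.of_hasFDerivAt {n : WithTop ℕ∞} (hn : ∞ ≤ n) {u : E → 𝕜} {l : E → E →L[𝕜] 𝕜}
    {s : Set E} (hs : IsOpen s) (hl : ContDiffOn 𝕜 n l s) (hu : ∀ y ∈ s, HasFDerivAt u (l y) y) :
    ContDiffOn 𝕜 n u s := by
  refine ContDiffOn.of_le (n := n + 1) ?_ le_self_add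
  rw [contDiffOn_succ_iff_fderiv_of_isOpen hs]
  refine ⟨fun y hy => (hu y hy).differentiableAt.differentiableWithinAt, ?_,
    hl.congr fun y hy => (hu y hy).fderiv⟩
  rintro rfl y hy
  refine AnalyticAt.analyticWithinAt (AnalyticAt.of_hasFDerivAt (l := l) ?_ ?_)
  · exact (hl.contDiffAt (hs.mem_nhds hy)).analyticAt
  · filter_upwards [hs.mem_nhds hy] with z hz using hu z hz

/-- **Poincaré lemma** for closed 1-forms of class `C^n`, on a ball. -/
theorem exists_contDiffOn_hasFDerivAt_of_closed {n : WithTop ℕ∞} (hn : ∞ ≤ n) {s : Set E} {p : E}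
    (hs : IsOpen s) (hp : p ∈ s) {l : E → E →L[𝕜] 𝕜} (hl : ContDiffOn 𝕜 n l s)
    (hcl : ∀ q ∈ s, ∀ a b, fderiv 𝕜 l q a b = fderiv 𝕜 l q b a) :
    ∃ r > 0, Metric.ball p r ⊆ s ∧ ∃ u : E → 𝕜, ContDiffOn 𝕜 n u (Metric.ball p r) ∧
      ∀ q ∈ Metric.ball p r, HasFDerivAt u (l q) q := by
  -- The primitive on the convex ball is found over `ℝ`; restricting scalars does not affect the
  -- symmetry of the derivative of `l`.
  let _ : NormedSpace ℝ E := NormedSpace.restrictScalars ℝ 𝕜 E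
  have : IsScalarTower ℝ 𝕜 E := RestrictScalars.isScalarTower ℝ 𝕜 E
  obtain ⟨r, hr, hrs⟩ := Metric.isOpen_iff.1 hs p hp
  have hd : ∀ q ∈ s, DifferentiableAt 𝕜 l q := fun q hq =>
    (hl.contDiffAt (hs.mem_nhds hq)).differentiableAt (by rintro rfl; simp at hn)
  obtain ⟨u, hu⟩ := (convex_ball p r).exists_forall_hasFDerivAt_of_fderiv_symmetric
    Metric.isOpen_ball
    (show DifferentiableOn ℝ l _ from fun q hq =>
      ((hd q (hrs hq)).restrictScalars ℝ).differentiableWithinAt)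
    (fun q hq a b => by
      rw [(hd q (hrs hq)).fderiv_restrictScalars ℝ]
      exact hcl q (hrs hq) a b)
  exact ⟨r, hr, hrs, u, ContDiffOn.of_hasFDerivAt hn Metric.isOpen_ball (hl.mono hrs) hu, hu⟩

end Poincare

/-! ### The regularity classes `∞` and `ω`. -/

noncomputable section

/-- Only `∞` and `ω` satisfy the hypothesis, and both absorb `1`. Thus derivatives stay in the class
`C^n`. -/
theorem add_one_le_of_infty_le {n : WithTop ℕ∞} (hn : ∞ ≤ n) : n + 1 ≤ n := by
  induction n using WithTop.recTopCoe with
  | top => exact le_top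
  | coe m =>
    have : m = ⊤ := top_le_iff.1 (WithTop.coe_le_coe.1 hn)
    subst this
    exact le_rfl

theorem two_le_of_infty_le {n : WithTop ℕ∞} (hn : ∞ ≤ n) : 2 ≤ n :=
  (WithTop.coe_le_coe.2 (le_top : (2 : ℕ∞) ≤ ⊤)).trans hn

theorem ne_zero_of_infty_le {n : WithTop ℕ∞} (hn : ∞ ≤ n) : n ≠ 0 := by
  rintro rfl
  simp at hn

theorem ContDiffOn.fderiv_of_infty_le {𝕜 E F : Type*} [RCLike 𝕜] [NormedAddCommGroup E]
    [NormedSpace 𝕜 E] [NormedAddCommGroup F] [NormedSpace 𝕜 F] {n : WithTop ℕ∞} (hn : ∞ ≤ n)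
    {f : E → F} {U : Set E} (hf : ContDiffOn 𝕜 n f U) (hU : IsOpen U) :
    ContDiffOn 𝕜 n (fderiv 𝕜 f) U :=
  hf.fderiv_of_isOpen hU (add_one_le_of_infty_le hn)

theorem ContDiffOn.differentiableAt_of_infty_le {𝕜 E F : Type*} [RCLike 𝕜] [NormedAddCommGroup E]
    [NormedSpace 𝕜 E] [NormedAddCommGroup F] [NormedSpace 𝕜 F] {n : WithTop ℕ∞} (hn : ∞ ≤ n)
    {f : E → F} {U : Set E} (hf : ContDiffOn 𝕜 n f U) (hU : IsOpen U) {q : E} (hq : q ∈ U) :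
    DifferentiableAt 𝕜 f q :=
  (hf.contDiffAt (hU.mem_nhds hq)).differentiableAt (ne_zero_of_infty_le hn)

theorem ContDiffOn.fderiv_fderiv_comm {𝕜 E F : Type*} [RCLike 𝕜] [NormedAddCommGroup E]
    [NormedSpace 𝕜 E] [NormedAddCommGroup F] [NormedSpace 𝕜 F] {n : WithTop ℕ∞} (hn : ∞ ≤ n)
    {f : E → F} {U : Set E} (hf : ContDiffOn 𝕜 n f U) (hU : IsOpen U) {q : E} (hq : q ∈ U)
    (a b : E) : fderiv 𝕜 (fderiv 𝕜 f) q a b = fderiv 𝕜 (fderiv 𝕜 f) q b a :=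
  ((hf.contDiffAt (hU.mem_nhds hq)).isSymmSndFDerivAt
    (by simpa using two_le_of_infty_le hn)).eq a b

namespace PlaneWeb

variable {𝕜 : Type*} [RCLike 𝕜]

/-! ### Dual frames -/

/-- The determinant of two 1-forms on the plane. -/
def formDet (α β : Plane 𝕜 →L[𝕜] 𝕜) : 𝕜 := α (1, 0) * β (0, 1) - α (0, 1) * β (1, 0)

/-- The first vector of the frame dual to the coframe `(α, β)`. -/
def dualFst (α β : Plane 𝕜 →L[𝕜] 𝕜) : Plane 𝕜 := (formDet α β)⁻¹ • (β (0, 1), -β (1, 0))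

/-- The second vector of the frame dual to the coframe `(α, β)`. -/
def dualSnd (α β : Plane 𝕜 →L[𝕜] 𝕜) : Plane 𝕜 := (formDet α β)⁻¹ • (-α (0, 1), α (1, 0))

theorem form_apply (α : Plane 𝕜 →L[𝕜] 𝕜) (a : Plane 𝕜) :
    α a = a.1 * α (1, 0) + a.2 * α (0, 1) := by
  have : a = a.1 • ((1, 0) : Plane 𝕜) + a.2 • ((0, 1) : Plane 𝕜) := by
    ext <;> simp
  conv_lhs => rw [this]
  rw [map_add, map_smul, map_smul, smul_eq_mul, smul_eq_mul]

theorem form_eq_zero {α : Plane 𝕜 →L[𝕜] 𝕜} (h : ((α (0, 1), -α (1, 0)) : Plane 𝕜) = 0) :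
    α = 0 := by
  rw [Prod.ext_iff] at h
  simp only [Prod.fst_zero, Prod.snd_zero, neg_eq_zero] at h
  refine ContinuousLinearMap.ext fun a => ?_
  rw [form_apply, h.1, h.2]
  simp

/-- If the determinant vanished, the vector spanning the kernel of either form would lie in both
kernels, forcing both forms to be zero. -/
theorem formDet_ne_zero {α β : Plane 𝕜 →L[𝕜] 𝕜} (h : ∀ a, α a = 0 → β a = 0 → a = 0) :
    formDet α β ≠ 0 := by
  intro h0
  rw [formDet] at h0
  have hα : α = 0 := form_eq_zero (h _ (by rw [form_apply]; ring)
    (by rw [form_apply]; linear_combination -h0))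
  have hβ : β = 0 := form_eq_zero (h _ (by rw [form_apply]; linear_combination h0)
    (by rw [form_apply]; ring))
  have := h (1, 0) (by simp [hα]) (by simp [hβ])
  simp [Prod.ext_iff] at this

section Coframe

variable {α β : Plane 𝕜 →L[𝕜] 𝕜}

theorem fst_dualFst (h : formDet α β ≠ 0) : α (dualFst α β) = 1 := by
  have h' := h
  rw [formDet] at h'
  rw [dualFst, map_smul, form_apply, formDet, smul_eq_mul]
  field_simp
  ring

theorem snd_dualFst : β (dualFst α β) = 0 := by
  rw [dualFst, map_smul, form_apply, smul_eq_mul]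
  ring

theorem fst_dualSnd : α (dualSnd α β) = 0 := by
  rw [dualSnd, map_smul, form_apply, smul_eq_mul]
  ring

theorem snd_dualSnd (h : formDet α β ≠ 0) : β (dualSnd α β) = 1 := by
  have h' := h
  rw [formDet] at h'
  rw [dualSnd, map_smul, form_apply, formDet, smul_eq_mul]
  field_simp
  ring

/-- Cramer's rule. Vector identities below are mostly checked by applying the two forms of a
coframe. -/
theorem coframe_ext (h : formDet α β ≠ 0) {a b : Plane 𝕜} (h1 : α a = α b) (h2 : β a = β b) : a = b := by
  rw [formDet] at h
  rw [form_apply α a, form_apply α b] at h1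
  rw [form_apply β a, form_apply β b] at h2
  ext
  · refine mul_left_cancel₀ h ?_
    linear_combination β (0, 1) * h1 - α (0, 1) * h2
  · refine mul_left_cancel₀ h ?_
    linear_combination α (1, 0) * h2 - β (1, 0) * h1

end Coframe

/-! ### Tensors built from forms and vectors -/

/-- The bilinear map `(a, b) ↦ B(a, b) e`. -/
def bilinSmul (B : Plane 𝕜 →L[𝕜] Plane 𝕜 →L[𝕜] 𝕜) (e : Plane 𝕜) : Bilin2 𝕜 :=
  ((ContinuousLinearMap.smulRightL 𝕜 (Plane 𝕜) (Plane 𝕜)).flip e) ∘L B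

@[simp]
theorem bilinSmul_apply (B : Plane 𝕜 →L[𝕜] Plane 𝕜 →L[𝕜] 𝕜) (e a b : Plane 𝕜) :
    bilinSmul B e a b = B a b • e := rfl

/-- The bilinear map `(a, b) ↦ σ(a) b + σ(b) a`. -/
def symId (σ : Plane 𝕜 →L[𝕜] 𝕜) : Bilin2 𝕜 :=
  σ.smulRight (ContinuousLinearMap.id 𝕜 (Plane 𝕜))
    + (σ.smulRight (ContinuousLinearMap.id 𝕜 (Plane 𝕜))).flip

@[simp]
theorem symId_apply (σ : Plane 𝕜 →L[𝕜] 𝕜) (a b : Plane 𝕜) :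
    symId σ a b = σ a • b + σ b • a := rfl

section Smoothness

variable {n : WithTop ℕ∞} {U : Set (Plane 𝕜)}

theorem contDiffOn_bilinSmul {B : Plane 𝕜 → Plane 𝕜 →L[𝕜] Plane 𝕜 →L[𝕜] 𝕜}
    {e : Plane 𝕜 → Plane 𝕜} (hB : ContDiffOn 𝕜 n B U) (he : ContDiffOn 𝕜 n e U) :
    ContDiffOn 𝕜 n (fun q => bilinSmul (B q) (e q)) U :=
  have h : ContDiff 𝕜 n fun e : Plane 𝕜 =>
      (ContinuousLinearMap.smulRightL 𝕜 (Plane 𝕜) (Plane 𝕜)).flip e :=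
    ContinuousLinearMap.contDiff _
  ContDiffOn.clm_comp (h.comp_contDiffOn he) hB

theorem contDiffOn_symId {σ : Plane 𝕜 → Plane 𝕜 →L[𝕜] 𝕜} (hσ : ContDiffOn 𝕜 n σ U) :
    ContDiffOn 𝕜 n (fun q => symId (σ q)) U := by
  have h1 : ContDiffOn 𝕜 n
      (fun q => (σ q).smulRight (ContinuousLinearMap.id 𝕜 (Plane 𝕜))) U :=
    hσ.smulRight contDiffOn_const
  have h : ContDiff 𝕜 n fun B : Bilin2 𝕜 =>
      ContinuousLinearMap.flipₗᵢ 𝕜 (Plane 𝕜) (Plane 𝕜) (Plane 𝕜) B :=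
    LinearIsometryEquiv.contDiff _
  exact h1.add (h.comp_contDiffOn h1)

variable {α β : Plane 𝕜 → Plane 𝕜 →L[𝕜] 𝕜} (hα : ContDiffOn 𝕜 n α U) (hβ : ContDiffOn 𝕜 n β U)
  (h : ∀ q ∈ U, formDet (α q) (β q) ≠ 0)
include hα hβ

theorem contDiffOn_formDet : ContDiffOn 𝕜 n (fun q => formDet (α q) (β q)) U :=
  ((hα.clm_apply contDiffOn_const).mul (hβ.clm_apply contDiffOn_const)).sub
    ((hα.clm_apply contDiffOn_const).mul (hβ.clm_apply contDiffOn_const))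

include h

theorem contDiffOn_dualFst : ContDiffOn 𝕜 n (fun q => dualFst (α q) (β q)) U :=
  ((contDiffOn_formDet hα hβ).inv h).smul
    ((hβ.clm_apply contDiffOn_const).prodMk (hβ.clm_apply contDiffOn_const).neg)

theorem contDiffOn_dualSnd : ContDiffOn 𝕜 n (fun q => dualSnd (α q) (β q)) U :=
  ((contDiffOn_formDet hα hβ).inv h).smul
    ((hα.clm_apply contDiffOn_const).neg.prodMk (hα.clm_apply contDiffOn_const))

end Smoothness

/-- The bilinear map `(a, b) ↦ B(a, b) e₁ + C(a, b) e₂`, where `e₁, e₂` is the frame dual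
to `dx, dy`. -/
def frameBilin (x y : Plane 𝕜 → 𝕜) (B C : Plane 𝕜 → Plane 𝕜 →L[𝕜] Plane 𝕜 →L[𝕜] 𝕜)
    (q : Plane 𝕜) : Bilin2 𝕜 :=
  bilinSmul (B q) (dualFst (fderiv 𝕜 x q) (fderiv 𝕜 y q))
    + bilinSmul (C q) (dualSnd (fderiv 𝕜 x q) (fderiv 𝕜 y q))

/-- The product rule for the composition of a field of 1-forms and a field of endomorphisms. -/
theorem fderiv_form_comp {φ ψ : Plane 𝕜 → Plane 𝕜 →L[𝕜] 𝕜} {A : Plane 𝕜 → End2 𝕜} {q : Plane 𝕜}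
    (hφ : DifferentiableAt 𝕜 φ q) (hA : DifferentiableAt 𝕜 A q)
    (h : ∀ᶠ x in 𝓝 q, ∀ b, φ x (A x b) = ψ x b) (a b : Plane 𝕜) :
    fderiv 𝕜 φ q a (A q b) + φ q (fderiv 𝕜 A q a b) = fderiv 𝕜 ψ q a b := by
  have ev : (fun x => φ x ∘L A x) =ᶠ[𝓝 q] ψ := by
    filter_upwards [h] with x hx using ContinuousLinearMap.ext hx
  rw [← ev.fderiv_eq, fderiv_clm_comp hφ hA]
  simp [add_comm]

end PlaneWeb

/-! ### The Chern connection and the pre-linearizations in a parallel chart. -/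

namespace ThreeWeb

variable {𝕜 : Type*} [RCLike 𝕜] {n : WithTop ℕ∞} {D : Set (Plane 𝕜)} (W : ThreeWeb 𝕜 n D)

/-- The 1-form whose kernels are to be the tangent lines of the `i`-th foliation
when the web consists of the level lines of `y`, `x` and `x + y`. -/
def webForm (x y : Plane 𝕜 → 𝕜) (i : Fin 3) (q : Plane 𝕜) : Plane 𝕜 →L[𝕜] 𝕜 :=
  (![0, 1, 1] i : 𝕜) • fderiv 𝕜 x q + (![1, 0, 1] i : 𝕜) • fderiv 𝕜 y q

theorem webForm_eq (x y : Plane 𝕜 → 𝕜) (i : Fin 3) : webForm x y i =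
    (![0, 1, 1] i : 𝕜) • fderiv 𝕜 x + (![1, 0, 1] i : 𝕜) • fderiv 𝕜 y := rfl

/-- On `U`, the foliations of the web are the level lines of `y`, `x` and `x + y`. -/
structure IsParallelChart (U : Set (Plane 𝕜)) (x y : Plane 𝕜 → 𝕜) : Prop where
  isOpen : IsOpen U
  subset : U ⊆ D
  contDiffOn_fst : ContDiffOn 𝕜 n x U
  contDiffOn_snd : ContDiffOn 𝕜 n y U
  tang_iff : ∀ i, ∀ q ∈ U, ∀ a, a ∈ W.tang i q ↔ webForm x y i q a = 0

namespace IsParallelChart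

variable {W} {U : Set (Plane 𝕜)} {x y : Plane 𝕜 → 𝕜} (hc : W.IsParallelChart U x y)
include hc

theorem mem_tang_zero {q : Plane 𝕜} (hq : q ∈ U) (a : Plane 𝕜) :
    a ∈ W.tang 0 q ↔ fderiv 𝕜 y q a = 0 := by
  simp [hc.tang_iff 0 q hq, webForm]

theorem mem_tang_one {q : Plane 𝕜} (hq : q ∈ U) (a : Plane 𝕜) :
    a ∈ W.tang 1 q ↔ fderiv 𝕜 x q a = 0 := by
  simp [hc.tang_iff 1 q hq, webForm]

theorem mem_tang_two {q : Plane 𝕜} (hq : q ∈ U) (a : Plane 𝕜) :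
    a ∈ W.tang 2 q ↔ fderiv 𝕜 x q a + fderiv 𝕜 y q a = 0 := by
  simp [hc.tang_iff 2 q hq, webForm]

/-- The kernels of `dx` and `dy` are the vertical and the horizontal line. Transversality of the web
thus makes `(x, y)` a coordinate system, without a separate condition in `IsParallelChart`. -/
theorem formDet_ne_zero {q : Plane 𝕜} (hq : q ∈ U) :
    formDet (fderiv 𝕜 x q) (fderiv 𝕜 y q) ≠ 0 :=
  PlaneWeb.formDet_ne_zero fun a h1 h2 =>
    Submodule.disjoint_def.1 (W.transversal 0 1 (by decide) q (hc.subset hq)).disjoint a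
      ((hc.mem_tang_zero hq a).2 h2) ((hc.mem_tang_one hq a).2 h1)

theorem ext {q : Plane 𝕜} (hq : q ∈ U) {a b : Plane 𝕜} (h1 : fderiv 𝕜 x q a = fderiv 𝕜 x q b)
    (h2 : fderiv 𝕜 y q a = fderiv 𝕜 y q b) : a = b :=
  coframe_ext (hc.formDet_ne_zero hq) h1 h2

theorem fst_h {q : Plane 𝕜} (hq : q ∈ U) (a : Plane 𝕜) :
    fderiv 𝕜 x q (W.h q a) = fderiv 𝕜 x q a := by
  have := (hc.mem_tang_one hq _).1 (W.v_mem (hc.subset hq) a)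
  rw [W.v_apply, map_sub, sub_eq_zero] at this
  exact this.symm

theorem snd_h {q : Plane 𝕜} (hq : q ∈ U) (a : Plane 𝕜) : fderiv 𝕜 y q (W.h q a) = 0 :=
  (hc.mem_tang_zero hq _).1 (W.h_mem (hc.subset hq) a)

/-- For horizontal `u`, `ju` is vertical and `u - ju` is transversal, whence `dx(u) = dy(ju)`. The
vertical part of `a` becomes horizontal under `j` and is killed by `dy`. -/
theorem snd_j {q : Plane 𝕜} (hq : q ∈ U) (a : Plane 𝕜) :
    fderiv 𝕜 y q (W.j q a) = fderiv 𝕜 x q a := by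
  have hD := hc.subset hq
  obtain ⟨m0, n0⟩ := W.j_of_mem_zero hD (W.h_mem hD a)
  have m1 := (W.j_of_mem_one hD (W.v_mem hD a)).1
  have ha : a = W.h q a + W.v q a := by rw [W.v_apply]; abel
  have e1 := (hc.mem_tang_zero hq _).1 m1
  have e2 := (hc.mem_tang_one hq _).1 m0
  have e3 := (hc.mem_tang_two hq _).1 n0
  rw [map_sub, map_sub, e2, hc.snd_h hq, hc.fst_h hq] at e3
  conv_lhs => rw [ha, map_add, map_add, e1]
  linear_combination -e3

theorem fst_j {q : Plane 𝕜} (hq : q ∈ U) (a : Plane 𝕜) :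
    fderiv 𝕜 x q (W.j q a) = fderiv 𝕜 y q a := by
  rw [← hc.snd_j hq, W.j_j (hc.subset hq)]

theorem contDiffOn_fderiv_fst (hn : ∞ ≤ n) : ContDiffOn 𝕜 n (fderiv 𝕜 x) U :=
  hc.contDiffOn_fst.fderiv_of_infty_le hn hc.isOpen

theorem contDiffOn_fderiv_snd (hn : ∞ ≤ n) : ContDiffOn 𝕜 n (fderiv 𝕜 y) U :=
  hc.contDiffOn_snd.fderiv_of_infty_le hn hc.isOpen

variable {B C : Plane 𝕜 → Plane 𝕜 →L[𝕜] Plane 𝕜 →L[𝕜] 𝕜}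

theorem fst_frameBilin {q : Plane 𝕜} (hq : q ∈ U) (a b : Plane 𝕜) :
    fderiv 𝕜 x q (frameBilin x y B C q a b) = B q a b := by
  simp [frameBilin, fst_dualFst (hc.formDet_ne_zero hq), fst_dualSnd]

theorem snd_frameBilin {q : Plane 𝕜} (hq : q ∈ U) (a b : Plane 𝕜) :
    fderiv 𝕜 y q (frameBilin x y B C q a b) = C q a b := by
  simp [frameBilin, snd_dualSnd (hc.formDet_ne_zero hq), snd_dualFst]

theorem contDiffOn_frameBilin (hn : ∞ ≤ n) (hB : ContDiffOn 𝕜 n B U) (hC : ContDiffOn 𝕜 n C U) :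
    ContDiffOn 𝕜 n (frameBilin x y B C) U :=
  (contDiffOn_bilinSmul hB (contDiffOn_dualFst (hc.contDiffOn_fderiv_fst hn)
    (hc.contDiffOn_fderiv_snd hn) fun _ => hc.formDet_ne_zero)).add
  (contDiffOn_bilinSmul hC (contDiffOn_dualSnd (hc.contDiffOn_fderiv_fst hn)
    (hc.contDiffOn_fderiv_snd hn) fun _ => hc.formDet_ne_zero))

/-- The forms `dx` and `dy` are parallel for the Chern connection. -/
theorem chern_eq (hn : ∞ ≤ n) (hD : IsOpen D) {q : Plane 𝕜} (hq : q ∈ U) :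
    W.chern q = frameBilin x y (fderiv 𝕜 (fderiv 𝕜 x)) (fderiv 𝕜 (fderiv 𝕜 y)) q := by
  have hqD := hc.subset hq
  have h2 := two_le_of_infty_le hn
  have hh := W.h_differentiableAt h2 hqD
  have hj := W.j_differentiableAt h2 hqD
  have hx := (hc.contDiffOn_fderiv_fst hn).differentiableAt_of_infty_le hn hc.isOpen hq
  have hy := (hc.contDiffOn_fderiv_snd hn).differentiableAt_of_infty_le hn hc.isOpen hq
  have hU := hc.isOpen.mem_nhds hq
  -- By uniqueness it suffices to test the right-hand side. Differentiating `dx ∘ h = dx`, `dy ∘ h =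
  -- 0`, `dx ∘ j = dy` and `dy ∘ j = dx` gives `∇h = 0` and `∇j = 0`; symmetry of second derivatives
  -- removes the torsion.
  refine IsChernAt.unique W hqD (W.chern_isChernAt h2 hD hqD) ⟨fun a b => ?_, fun a b => ?_,
    fun a b => ?_⟩
  · have e1 := fderiv_form_comp hx hh (mem_of_superset hU fun z hz => hc.fst_h hz) a b
    have e2 := fderiv_form_comp (ψ := 0) hy hh (mem_of_superset hU fun z hz => hc.snd_h hz) a b
    rw [covDerivEnd]
    refine hc.ext hq ?_ ?_
    · rw [map_sub, map_add, hc.fst_h hq, hc.fst_frameBilin hq, hc.fst_frameBilin hq, map_zero,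
        ← e1]
      ring
    · rw [map_sub, map_add, hc.snd_h hq, hc.snd_frameBilin hq, map_zero, sub_zero, add_comm, e2]
      simp
  · have e1 := fderiv_form_comp hx hj (mem_of_superset hU fun z hz => hc.fst_j hz) a b
    have e2 := fderiv_form_comp hy hj (mem_of_superset hU fun z hz => hc.snd_j hz) a b
    rw [covDerivEnd]
    refine hc.ext hq ?_ ?_
    · rw [map_sub, map_add, hc.fst_j hq, hc.fst_frameBilin hq, hc.snd_frameBilin hq, map_zero,
        ← e1]
      ring
    · rw [map_sub, map_add, hc.snd_j hq, hc.fst_frameBilin hq, hc.snd_frameBilin hq, map_zero,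
        ← e2]
      ring
  · rw [torsion]
    refine hc.ext hq ?_ ?_
    · rw [map_sub, hc.fst_frameBilin hq, hc.fst_frameBilin hq,
        hc.contDiffOn_fst.fderiv_fderiv_comm hn hc.isOpen hq, sub_self, map_zero]
    · rw [map_sub, hc.snd_frameBilin hq, hc.snd_frameBilin hq,
        hc.contDiffOn_snd.fderiv_fderiv_comm hn hc.isOpen hq, sub_self, map_zero]

theorem fst_chern (hn : ∞ ≤ n) (hD : IsOpen D) {q : Plane 𝕜} (hq : q ∈ U) (a b : Plane 𝕜) :
    fderiv 𝕜 x q (W.chern q a b) = fderiv 𝕜 (fderiv 𝕜 x) q a b := by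
  rw [hc.chern_eq hn hD hq, hc.fst_frameBilin hq]

theorem snd_chern (hn : ∞ ≤ n) (hD : IsOpen D) {q : Plane 𝕜} (hq : q ∈ U) (a b : Plane 𝕜) :
    fderiv 𝕜 y q (W.chern q a b) = fderiv 𝕜 (fderiv 𝕜 y) q a b := by
  rw [hc.chern_eq hn hD hq, hc.snd_frameBilin hq]

theorem contDiffOn_chern (hn : ∞ ≤ n) (hD : IsOpen D) : ContDiffOn 𝕜 n W.chern U :=
  (hc.contDiffOn_frameBilin hn ((hc.contDiffOn_fderiv_fst hn).fderiv_of_infty_le hn hc.isOpen)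
    ((hc.contDiffOn_fderiv_snd hn).fderiv_of_infty_le hn hc.isOpen)).congr
    fun _ hq => hc.chern_eq hn hD hq

theorem differentiableAt_webForm (hn : ∞ ≤ n) (i : Fin 3) {q : Plane 𝕜} (hq : q ∈ U) :
    DifferentiableAt 𝕜 (webForm x y i) q := by
  rw [webForm_eq]
  exact (((hc.contDiffOn_fderiv_fst hn).differentiableAt_of_infty_le hn hc.isOpen hq).const_smul _).add
    (((hc.contDiffOn_fderiv_snd hn).differentiableAt_of_infty_le hn hc.isOpen hq).const_smul _)

/-- The three forms are combinations of `dx` and `dy` with constant coefficients, so they are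
parallel too. -/
theorem webForm_chern (hn : ∞ ≤ n) (hD : IsOpen D) (i : Fin 3) {q : Plane 𝕜} (hq : q ∈ U)
    (a b : Plane 𝕜) :
    webForm x y i q (W.chern q a b) = fderiv 𝕜 (webForm x y i) q a b := by
  have hx := (hc.contDiffOn_fderiv_fst hn).differentiableAt_of_infty_le hn hc.isOpen hq
  have hy := (hc.contDiffOn_fderiv_snd hn).differentiableAt_of_infty_le hn hc.isOpen hq
  have e : fderiv 𝕜 (webForm x y i) q = (![0, 1, 1] i : 𝕜) • fderiv 𝕜 (fderiv 𝕜 x) q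
      + (![1, 0, 1] i : 𝕜) • fderiv 𝕜 (fderiv 𝕜 y) q := by
    rw [webForm_eq]
    exact ((hx.hasFDerivAt.const_smul _).add (hy.hasFDerivAt.const_smul _)).fderiv
  rw [e]
  simp [webForm, hc.fst_chern hn hD hq, hc.snd_chern hn hD hq]

/-- For a vector field `X` tangent to the `i`-th foliation, `∇_X X` is also tangent, where `∇`
is the Chern connection. -/
theorem webForm_covDeriv_chern_add (hn : ∞ ≤ n) (hD : IsOpen D) (i : Fin 3) {q : Plane 𝕜}
    (hq : q ∈ U) {X : Plane 𝕜 → Plane 𝕜} (hX : DifferentiableAt 𝕜 X q)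
    (hXi : ∀ᶠ z in 𝓝 q, X z ∈ W.tang i z) (L₀ : Bilin2 𝕜) :
    webForm x y i q (covDeriv (W.chern q + L₀) q (X q) X) = webForm x y i q (L₀ (X q) (X q)) := by
  -- The form is parallel and vanishes on `X`. Differentiating this identity along `X` shows that
  -- `∇_X X` contributes nothing.
  have hz : (fun z => webForm x y i z (X z)) =ᶠ[𝓝 q] fun _ => 0 := by
    filter_upwards [hXi, hc.isOpen.mem_nhds hq] with z hz hzU
    exact (hc.tang_iff i z hzU _).1 hz
  have hd := ((hc.differentiableAt_webForm hn i hq).hasFDerivAt.clm_apply hX.hasFDerivAt).fderiv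
  rw [hz.fderiv_eq, fderiv_fun_const] at hd
  have hd' := congrArg (fun A : Plane 𝕜 →L[𝕜] 𝕜 => A (X q)) hd
  simp at hd'
  rw [covDeriv, _root_.add_apply, _root_.add_apply, map_add, map_add,
    hc.webForm_chern hn hD i hq]
  linear_combination -hd'

/-- The fibre of the bundle of pre-linearizations, in a parallel chart. -/
theorem mem_E_iff (hn : ∞ ≤ n) (hD : IsOpen D) {q : Plane 𝕜} (hq : q ∈ U) (L₀ : Bilin2 𝕜) :
    L₀ ∈ W.E q ↔ (∀ a b, L₀ a b = L₀ b a) ∧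
      ∀ i a, webForm x y i q a = 0 → webForm x y i q (L₀ a a) = 0 := by
  refine and_congr_right fun _ => forall_congr' fun i => ⟨fun h a ha => ?_, fun h X hX hXi => ?_⟩
  -- Extend `a` to a field with constant coefficients in the dual frame. It stays tangent to the
  -- foliation since the web form has constant coefficients in `dx, dy`.
  · set X : Plane 𝕜 → Plane 𝕜 := fun z =>
      fderiv 𝕜 x q a • dualFst (fderiv 𝕜 x z) (fderiv 𝕜 y z)
        + fderiv 𝕜 y q a • dualSnd (fderiv 𝕜 x z) (fderiv 𝕜 y z) with hXdef
    have hx := hc.contDiffOn_fderiv_fst hn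
    have hy := hc.contDiffOn_fderiv_snd hn
    have h1 : DifferentiableAt 𝕜 X q :=
      (((contDiffOn_dualFst hx hy fun _ => hc.formDet_ne_zero).differentiableAt_of_infty_le hn
        hc.isOpen hq).fun_const_smul _).fun_add
      (((contDiffOn_dualSnd hx hy fun _ => hc.formDet_ne_zero).differentiableAt_of_infty_le hn
        hc.isOpen hq).fun_const_smul _)
    have hfst : ∀ z ∈ U, fderiv 𝕜 x z (X z) = fderiv 𝕜 x q a := fun z hz => by
      simp [hXdef, fst_dualFst (hc.formDet_ne_zero hz), fst_dualSnd]
    have hsnd : ∀ z ∈ U, fderiv 𝕜 y z (X z) = fderiv 𝕜 y q a := fun z hz => by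
      simp [hXdef, snd_dualSnd (hc.formDet_ne_zero hz), snd_dualFst]
    have h2 : ∀ᶠ z in 𝓝 q, X z ∈ W.tang i z := by
      filter_upwards [hc.isOpen.mem_nhds hq] with z hz
      rw [hc.tang_iff i z hz, ← ha]
      simp [webForm, hfst z hz, hsnd z hz]
    have h3 : X q = a := hc.ext hq (hfst q hq) (hsnd q hq)
    have := (hc.tang_iff i q hq _).1 (h X h1 h2)
    rwa [hc.webForm_covDeriv_chern_add hn hD i hq h1 h2, h3] at this
  · rw [hc.tang_iff i q hq, hc.webForm_covDeriv_chern_add hn hD i hq hX hXi]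
    exact h _ ((hc.tang_iff i q hq _).1 hXi.self_of_nhds)

end IsParallelChart

end ThreeWeb

/-! ### Curvature, recurrent 1-forms and projective changes. -/

namespace PlaneWeb

variable {𝕜 : Type*} [RCLike 𝕜]

theorem fderiv_bilin_apply {Γ : Plane 𝕜 → Bilin2 𝕜} {q : Plane 𝕜} (hΓ : DifferentiableAt 𝕜 Γ q)
    (X Y Z : Plane 𝕜) : fderiv 𝕜 (fun z => Γ z Y Z) q X = fderiv 𝕜 Γ q X Y Z := by
  have h1 := hΓ.hasFDerivAt.clm_apply (hasFDerivAt_const Y q)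
  have h2 := (h1.clm_apply (hasFDerivAt_const Z q)).fderiv
  rw [h2]
  simp

/-- If `∇φ = l ⊗ φ` for a 1-form `φ`, then `φ(R(X, Y) Z) = -dl(X, Y) φ(Z)`. -/
theorem form_curvature {n : WithTop ℕ∞} (hn : ∞ ≤ n) {U : Set (Plane 𝕜)} (hU : IsOpen U)
    {Γ : Plane 𝕜 → Bilin2 𝕜} {φ l : Plane 𝕜 → Plane 𝕜 →L[𝕜] 𝕜} (hφ : ContDiffOn 𝕜 n φ U)
    (h : ∀ z ∈ U, ∀ a b, fderiv 𝕜 φ z a b = l z a * φ z b + φ z (Γ z a b))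
    {q : Plane 𝕜} (hq : q ∈ U) (hΓ : DifferentiableAt 𝕜 Γ q) (hl : DifferentiableAt 𝕜 l q)
    (X Y Z : Plane 𝕜) :
    φ q (curvature Γ q X Y Z) = -((fderiv 𝕜 l q X Y - fderiv 𝕜 l q Y X) * φ q Z) := by
  have hφd := hφ.differentiableAt_of_infty_le hn hU hq
  have hφd' := (hφ.fderiv_of_infty_le hn hU).differentiableAt_of_infty_le hn hU hq
  have key : ∀ X Y : Plane 𝕜, fderiv 𝕜 (fderiv 𝕜 φ) q X Y Z =
      fderiv 𝕜 l q X Y * φ q Z + l q Y * fderiv 𝕜 φ q X Z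
        + (fderiv 𝕜 φ q X (Γ q Y Z) + φ q (fderiv 𝕜 Γ q X Y Z)) := by
    intro X Y
    have ev : (fun z => fderiv 𝕜 φ z Y Z) =ᶠ[𝓝 q]
        fun z => l z Y * φ z Z + φ z (Γ z Y Z) := by
      filter_upwards [hU.mem_nhds hq] with z hz using h z hz Y Z
    have e0 : fderiv 𝕜 (fun z => fderiv 𝕜 φ z Y Z) q X = fderiv 𝕜 (fderiv 𝕜 φ) q X Y Z := by
      have h1 := hφd'.hasFDerivAt.clm_apply (hasFDerivAt_const Y q)
      have h2 := (h1.clm_apply (hasFDerivAt_const Z q)).fderiv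
      rw [h2]
      simp
    have d1 := hl.hasFDerivAt.clm_apply (hasFDerivAt_const Y q)
    have d2 := hφd.hasFDerivAt.clm_apply (hasFDerivAt_const Z q)
    have d3 := (hΓ.hasFDerivAt.clm_apply (hasFDerivAt_const Y q)).clm_apply (hasFDerivAt_const Z q)
    have d4 := hφd.hasFDerivAt.clm_apply d3
    rw [← e0, ev.fderiv_eq, ((d1.fun_mul d2).fun_add d4).fderiv]
    simp
    ring
  -- Second derivatives of `φ` are symmetric in `X, Y`. After substituting the equation for `Dφ`
  -- again, the terms involving `l` undifferentiated are symmetric as well and cancel.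
  have hs := congrArg (fun A : Plane 𝕜 →L[𝕜] 𝕜 => A Z) (hφ.fderiv_fderiv_comm hn hU hq X Y)
  simp only [key, h q hq] at hs
  simp only [curvature, map_add, map_sub]
  linear_combination hs

/-- The projective change of a connection by a 1-form `σ` with `∇σ = σ ⊗ σ` does not change
the curvature. -/
theorem curvature_add_symId {Γ : Plane 𝕜 → Bilin2 𝕜} {σ : Plane 𝕜 → Plane 𝕜 →L[𝕜] 𝕜}
    {q : Plane 𝕜} (hΓ : DifferentiableAt 𝕜 Γ q) (hσ : DifferentiableAt 𝕜 σ q)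
    (hs : DifferentiableAt 𝕜 (fun z => Γ z + symId (σ z)) q)
    (hsymm : ∀ a b, Γ q a b = Γ q b a)
    (h : ∀ a b, fderiv 𝕜 σ q a b = σ q (Γ q a b) + σ q a * σ q b) (X Y Z : Plane 𝕜) :
    curvature (fun z => Γ z + symId (σ z)) q X Y Z = curvature Γ q X Y Z := by
  have hd : ∀ X Y Z, fderiv 𝕜 (fun z => Γ z + symId (σ z)) q X Y Z
      = fderiv 𝕜 Γ q X Y Z + (fderiv 𝕜 σ q X Y • Z + fderiv 𝕜 σ q X Z • Y) := by
    intro X Y Z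
    rw [← fderiv_bilin_apply hs]
    have h0 := (hΓ.hasFDerivAt.clm_apply (hasFDerivAt_const Y q)).clm_apply (hasFDerivAt_const Z q)
    have h1 := (hσ.hasFDerivAt.clm_apply (hasFDerivAt_const Y q)).smul_const Z
    have h2 := (hσ.hasFDerivAt.clm_apply (hasFDerivAt_const Z q)).smul_const Y
    have h3 := (h0.fun_add (h1.fun_add h2)).fderiv
    change fderiv 𝕜 (fun z => Γ z Y Z + (σ z Y • Z + σ z Z • Y)) q X = _
    rw [h3]
    simp
  -- Symmetry of `Γ` makes `Dσ` symmetric, so its multiples of `Z` cancel. Its multiples of `X` and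
  -- `Y` cancel against the terms quadratic in the Christoffel forms.
  simp only [curvature, hd, _root_.add_apply, symId_apply, h, map_add, map_smul, hsymm Y X]
  module

/-- The 1-form `e^{c (f - f(p))} df`. -/
def expForm (c : 𝕜) (f : Plane 𝕜 → 𝕜) (p z : Plane 𝕜) : Plane 𝕜 →L[𝕜] 𝕜 :=
  NormedSpace.exp (c * (f z - f p)) • fderiv 𝕜 f z

theorem contDiff_exp {n : WithTop ℕ∞} : ContDiff 𝕜 n (NormedSpace.exp : 𝕜 → 𝕜) :=
  contDiff_iff_contDiffAt.2 fun z => (NormedSpace.exp_analytic z).contDiffAt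

theorem exp_ne_zero (z : 𝕜) : NormedSpace.exp z ≠ 0 :=
  (NormedSpace.isUnit_exp z).ne_zero

theorem expForm_self (c : 𝕜) (f : Plane 𝕜 → 𝕜) (p : Plane 𝕜) :
    expForm c f p p = fderiv 𝕜 f p := by
  simp [expForm]

section

variable {n : WithTop ℕ∞} (hn : ∞ ≤ n) {U : Set (Plane 𝕜)} (hU : IsOpen U) {f : Plane 𝕜 → 𝕜}
  (hf : ContDiffOn 𝕜 n f U)
include hn hU hf

theorem contDiffOn_expForm (c : 𝕜) (p : Plane 𝕜) : ContDiffOn 𝕜 n (expForm c f p) U :=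
  (contDiff_exp.comp_contDiffOn (contDiffOn_const.mul (hf.sub contDiffOn_const))).smul
    (hf.fderiv_of_infty_le hn hU)

theorem fderiv_expForm (c : 𝕜) (p : Plane 𝕜) {q : Plane 𝕜} (hq : q ∈ U) (a b : Plane 𝕜) :
    fderiv 𝕜 (expForm c f p) q a b = NormedSpace.exp (c * (f q - f p)) *
      (fderiv 𝕜 (fderiv 𝕜 f) q a b + c * fderiv 𝕜 f q a * fderiv 𝕜 f q b) := by
  have h1 := (hf.differentiableAt_of_infty_le hn hU hq).hasFDerivAt
  have h2 := ((hf.fderiv_of_infty_le hn hU).differentiableAt_of_infty_le hn hU hq).hasFDerivAt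
  have h3 := (hasDerivAt_exp (x := c * (f q - f p))).comp_hasFDerivAt q
    ((h1.sub_const (f p)).const_mul c)
  have h4 := (h3.smul h2).fderiv
  change fderiv 𝕜 (expForm c f p) q = _ at h4
  rw [h4]
  simp
  ring

end

end PlaneWeb

/-! ### Construction of linearizations in a parallel chart. -/

namespace ThreeWeb

variable {𝕜 : Type*} [RCLike 𝕜] {n : WithTop ℕ∞} {D : Set (Plane 𝕜)} {W : ThreeWeb 𝕜 n D}

/-- The tensor `t (dx ⊗ dx ⊗ e₁ - dy ⊗ dy ⊗ e₂)`, where `e₁, e₂` is the frame dual to `dx, dy`. -/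
def webTensor (x y : Plane 𝕜 → 𝕜) (t : 𝕜) : Plane 𝕜 → Bilin2 𝕜 :=
  frameBilin x y (fun q => (t • fderiv 𝕜 x q).smulRight (fderiv 𝕜 x q))
    (fun q => (-t • fderiv 𝕜 y q).smulRight (fderiv 𝕜 y q))

namespace IsParallelChart

variable {U : Set (Plane 𝕜)} {x y : Plane 𝕜 → 𝕜} (hc : W.IsParallelChart U x y)
include hc

theorem fst_webTensor (t : 𝕜) {q : Plane 𝕜} (hq : q ∈ U) (a b : Plane 𝕜) :
    fderiv 𝕜 x q (webTensor x y t q a b) = t * fderiv 𝕜 x q a * fderiv 𝕜 x q b := by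
  simp [webTensor, hc.fst_frameBilin hq]

theorem snd_webTensor (t : 𝕜) {q : Plane 𝕜} (hq : q ∈ U) (a b : Plane 𝕜) :
    fderiv 𝕜 y q (webTensor x y t q a b) = -t * fderiv 𝕜 y q a * fderiv 𝕜 y q b := by
  simp [webTensor, hc.snd_frameBilin hq]

theorem contDiffOn_webTensor (hn : ∞ ≤ n) (t : 𝕜) : ContDiffOn 𝕜 n (webTensor x y t) U :=
  hc.contDiffOn_frameBilin hn
    (((hc.contDiffOn_fderiv_fst hn).const_smul t).smulRight (hc.contDiffOn_fderiv_fst hn))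
    (((hc.contDiffOn_fderiv_snd hn).const_smul (-t)).smulRight (hc.contDiffOn_fderiv_snd hn))

theorem chern_symm (hn : ∞ ≤ n) (hD : IsOpen D) {q : Plane 𝕜} (hq : q ∈ U) (a b : Plane 𝕜) :
    W.chern q a b = W.chern q b a := by
  refine hc.ext hq ?_ ?_
  · rw [hc.fst_chern hn hD hq, hc.fst_chern hn hD hq,
      hc.contDiffOn_fst.fderiv_fderiv_comm hn hc.isOpen hq]
  · rw [hc.snd_chern hn hD hq, hc.snd_chern hn hD hq,
      hc.contDiffOn_snd.fderiv_fderiv_comm hn hc.isOpen hq]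

theorem webTensor_symm (t : 𝕜) {q : Plane 𝕜} (hq : q ∈ U) (a b : Plane 𝕜) :
    webTensor x y t q a b = webTensor x y t q b a := by
  refine hc.ext hq ?_ ?_
  · rw [hc.fst_webTensor t hq, hc.fst_webTensor t hq]; ring
  · rw [hc.snd_webTensor t hq, hc.snd_webTensor t hq]; ring

/-- `symId σ` sends `(a, a)` to a multiple of `a`, which is harmless for every foliation. On
`webTensor` at `(a, a)`, `dx + dy` takes the value `t (dx(a)² - dy(a)²)`, divisible by `dx(a) +
dy(a)`; the other two foliations are immediate. -/
theorem webTensor_add_symId_mem_E (hn : ∞ ≤ n) (hD : IsOpen D) (t : 𝕜) (σ : Plane 𝕜 →L[𝕜] 𝕜)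
    {q : Plane 𝕜} (hq : q ∈ U) : webTensor x y t q + symId σ ∈ W.E q := by
  rw [hc.mem_E_iff hn hD hq]
  refine ⟨fun a b => ?_, fun i a ha => ?_⟩
  · rw [_root_.add_apply, _root_.add_apply, _root_.add_apply, _root_.add_apply,
      hc.webTensor_symm t hq, symId_apply, symId_apply, add_comm (σ a • b)]
  · rw [_root_.add_apply, _root_.add_apply, map_add, symId_apply, map_add, map_smul, ha]
    have e : webForm x y i q (webTensor x y t q a a) = (![0, 1, 1] i : 𝕜) *
        (t * fderiv 𝕜 x q a * fderiv 𝕜 x q a)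
        + (![1, 0, 1] i : 𝕜) * (-t * fderiv 𝕜 y q a * fderiv 𝕜 y q a) := by
      rw [← hc.fst_webTensor t hq, ← hc.snd_webTensor t hq]
      rfl
    have ha' : (![0, 1, 1] i : 𝕜) * fderiv 𝕜 x q a + (![1, 0, 1] i : 𝕜) * fderiv 𝕜 y q a = 0 := ha
    rw [e]
    fin_cases i <;> simp at ha' ⊢
    · simp [ha']
    · simp [ha']
    · linear_combination t * (fderiv 𝕜 x q a - fderiv 𝕜 y q a) * ha'

/-- A symmetric tensor has six coordinates in the frame `e₁, e₂`. Testing on `e₁`, `e₂` and `e₁ -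
e₂`, which span the three tangent lines, leaves the parameters `t`, `α`, `β`. -/
theorem exists_eq_of_mem_E (hn : ∞ ≤ n) (hD : IsOpen D) {q : Plane 𝕜} (hq : q ∈ U)
    {L₀ : Bilin2 𝕜} (hL : L₀ ∈ W.E q) : ∃ t α β : 𝕜,
      L₀ = webTensor x y t q + symId (α • fderiv 𝕜 x q + β • fderiv 𝕜 y q) := by
  obtain ⟨hs, hL⟩ := (hc.mem_E_iff hn hD hq L₀).1 hL
  have hdet := hc.formDet_ne_zero hq
  set e₁ := dualFst (fderiv 𝕜 x q) (fderiv 𝕜 y q) with he₁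
  set e₂ := dualSnd (fderiv 𝕜 x q) (fderiv 𝕜 y q) with he₂
  have x1 : fderiv 𝕜 x q e₁ = 1 := fst_dualFst hdet
  have y1 : fderiv 𝕜 y q e₁ = 0 := snd_dualFst
  have x2 : fderiv 𝕜 x q e₂ = 0 := fst_dualSnd
  have y2 : fderiv 𝕜 y q e₂ = 1 := snd_dualSnd hdet
  have hdec : ∀ a, a = fderiv 𝕜 x q a • e₁ + fderiv 𝕜 y q a • e₂ := fun a =>
    hc.ext hq (by simp [x1, x2]) (by simp [y1, y2])
  have h0 : fderiv 𝕜 y q (L₀ e₁ e₁) = 0 := by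
    simpa [webForm] using hL 0 e₁ (by simp [webForm, y1])
  have h1 : fderiv 𝕜 x q (L₀ e₂ e₂) = 0 := by
    simpa [webForm] using hL 1 e₂ (by simp [webForm, x2])
  have h2 := hL 2 (e₁ - e₂) (by simp [webForm, x1, x2, y1, y2])
  simp only [webForm, map_sub, _root_.sub_apply, hs e₂ e₁, _root_.add_apply, _root_.smul_apply,
    Matrix.cons_val, smul_eq_mul, one_mul, h0, h1] at h2
  -- At `(e₁, e₂)` the tensor sought equals `β e₁ + α e₂`, which fixes `α` and `β`. Its value at
  -- `(e₁, e₁)` is `(t + 2α) e₁`, which fixes `t`. The value at `(e₂, e₂)` is then forced by `h2`.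
  refine ⟨fderiv 𝕜 x q (L₀ e₁ e₁) - 2 * fderiv 𝕜 y q (L₀ e₁ e₂), fderiv 𝕜 y q (L₀ e₁ e₂),
    fderiv 𝕜 x q (L₀ e₁ e₂), ContinuousLinearMap.ext fun a => ContinuousLinearMap.ext fun b => ?_⟩
  have hab : L₀ a b = fderiv 𝕜 x q a • fderiv 𝕜 x q b • L₀ e₁ e₁
      + (fderiv 𝕜 x q a * fderiv 𝕜 y q b + fderiv 𝕜 y q a * fderiv 𝕜 x q b) • L₀ e₁ e₂
      + fderiv 𝕜 y q a • fderiv 𝕜 y q b • L₀ e₂ e₂ := by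
    conv_lhs => rw [hdec a, hdec b]
    simp only [map_add, map_smul, _root_.add_apply, _root_.smul_apply, hs e₂ e₁]
    module
  rw [hab]
  refine hc.ext hq ?_ ?_
  · simp only [map_add, map_smul, smul_eq_mul, _root_.add_apply, _root_.smul_apply,
      hc.fst_webTensor _ hq, symId_apply, h1]
    ring
  · simp only [map_add, map_smul, smul_eq_mul, _root_.add_apply, _root_.smul_apply,
      hc.snd_webTensor _ hq, symId_apply, h0]
    linear_combination fderiv 𝕜 y q a * fderiv 𝕜 y q b * h2

/-- The 1-form `e^{t (x - x(p))} dx` is parallel for the connection `∇ + webTensor t`. -/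
theorem fderiv_expForm_fst (hn : ∞ ≤ n) (hD : IsOpen D) (t : 𝕜) (p : Plane 𝕜) {q : Plane 𝕜}
    (hq : q ∈ U) (a b : Plane 𝕜) : fderiv 𝕜 (expForm t x p) q a b =
      expForm t x p q ((W.chern q + webTensor x y t q) a b) := by
  rw [fderiv_expForm hn hc.isOpen hc.contDiffOn_fst t p hq, expForm, _root_.smul_apply,
    _root_.add_apply, _root_.add_apply, map_add, hc.fst_chern hn hD hq, hc.fst_webTensor t hq,
    smul_eq_mul]

theorem fderiv_expForm_snd (hn : ∞ ≤ n) (hD : IsOpen D) (t : 𝕜) (p : Plane 𝕜) {q : Plane 𝕜}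
    (hq : q ∈ U) (a b : Plane 𝕜) : fderiv 𝕜 (expForm (-t) y p) q a b =
      expForm (-t) y p q ((W.chern q + webTensor x y t q) a b) := by
  rw [fderiv_expForm hn hc.isOpen hc.contDiffOn_snd (-t) p hq, expForm, _root_.smul_apply,
    _root_.add_apply, _root_.add_apply, map_add, hc.snd_chern hn hD hq, hc.snd_webTensor t hq,
    smul_eq_mul]

theorem differentiableAt_chern_add (hn : ∞ ≤ n) (hD : IsOpen D) (t : 𝕜) {q : Plane 𝕜}
    (hq : q ∈ U) : DifferentiableAt 𝕜 (fun z => W.chern z + webTensor x y t z) q :=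
  ((hc.contDiffOn_chern hn hD).add (hc.contDiffOn_webTensor hn t)).differentiableAt_of_infty_le hn
    hc.isOpen hq

theorem curvature_chern_add_webTensor (hn : ∞ ≤ n) (hD : IsOpen D) (t : 𝕜) {q : Plane 𝕜}
    (hq : q ∈ U) (X Y Z : Plane 𝕜) :
    curvature (fun z => W.chern z + webTensor x y t z) q X Y Z = 0 := by
  have hd := hc.differentiableAt_chern_add hn hD t hq
  -- A parallel form is the case `l = 0`, so it kills all values of the curvature. With base point
  -- `q` the two exponential forms are `dx` and `dy` at `q`.
  have e1 := form_curvature hn hc.isOpen (l := fun _ => 0)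
    (contDiffOn_expForm hn hc.isOpen hc.contDiffOn_fst t q)
    (fun z hz a b => by simpa using hc.fderiv_expForm_fst hn hD t q hz a b) hq hd
    (differentiableAt_const _) X Y Z
  have e2 := form_curvature hn hc.isOpen (l := fun _ => 0)
    (contDiffOn_expForm hn hc.isOpen hc.contDiffOn_snd (-t) q)
    (fun z hz a b => by simpa using hc.fderiv_expForm_snd hn hD t q hz a b) hq hd
    (differentiableAt_const _) X Y Z
  rw [expForm_self] at e1 e2
  refine hc.ext hq ?_ ?_
  · simpa using e1
  · simpa using e2

/-- There is a linearization with any given value of the form `webTensor t + symId σ` at `p`. -/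
theorem exists_linearization (hn : ∞ ≤ n) (hD : IsOpen D) {p : Plane 𝕜} (hp : p ∈ U)
    (t α β : 𝕜) : ∃ L, W.IsLinearizationGerm p L ∧
      L p = webTensor x y t p + symId (α • fderiv 𝕜 x p + β • fderiv 𝕜 y p) := by
  have hU := hc.isOpen
  -- A parallel form for `∇ + webTensor t` with the prescribed value at `p`, where both exponentials
  -- equal `1`.
  set φ : Plane 𝕜 → Plane 𝕜 →L[𝕜] 𝕜 := fun z => α • expForm t x p z + β • expForm (-t) y p z
    with hφdef
  have c1 := contDiffOn_expForm hn hU hc.contDiffOn_fst t p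
  have c2 := contDiffOn_expForm hn hU hc.contDiffOn_snd (-t) p
  have hφ : ContDiffOn 𝕜 n φ U := (c1.const_smul α).add (c2.const_smul β)
  have hpar : ∀ q ∈ U, ∀ a b,
      fderiv 𝕜 φ q a b = φ q ((W.chern q + webTensor x y t q) a b) := by
    intro q hq a b
    have h1 := (c1.differentiableAt_of_infty_le hn hU hq).hasFDerivAt
    have h2 := (c2.differentiableAt_of_infty_le hn hU hq).hasFDerivAt
    have h3 : fderiv 𝕜 φ q = _ := ((h1.const_smul α).add (h2.const_smul β)).fderiv
    rw [h3, _root_.add_apply, _root_.add_apply, _root_.smul_apply, _root_.smul_apply,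
      _root_.smul_apply, _root_.smul_apply, hc.fderiv_expForm_fst hn hD t p hq,
      hc.fderiv_expForm_snd hn hD t p hq]
    rfl
  have hsymm : ∀ q ∈ U, ∀ a b, (W.chern q + webTensor x y t q) a b
      = (W.chern q + webTensor x y t q) b a := by
    intro q hq a b
    simp only [_root_.add_apply, hc.chern_symm hn hD hq a b, hc.webTensor_symm t hq a b]
  -- A parallel form of a torsion-free connection is closed.
  obtain ⟨r, hr, hrU, w, hw, hw'⟩ := exists_contDiffOn_hasFDerivAt_of_closed hn hU hp hφ
    fun q hq a b => by rw [hpar q hq, hpar q hq, hsymm q hq]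
  -- Chosen so that `du = -φ` and `u(p) = 1`. Then `σ = φ / u` has covariant derivative `φ ⊗ φ / u²
  -- = σ ⊗ σ` and `σ_p = φ_p`.
  set u : Plane 𝕜 → 𝕜 := fun z => 1 + w p - w z with hu
  have hup : u p = 1 := by simp [hu]
  have huc : ContDiffOn 𝕜 n u (Metric.ball p r) := contDiffOn_const.sub hw
  have hu' : ∀ q ∈ Metric.ball p r, HasFDerivAt u (-φ q) q := fun q hq =>
    (hw' q hq).const_sub _
  set V := Metric.ball p r ∩ u ⁻¹' {0}ᶜ with hV
  have hVo : IsOpen V := huc.continuousOn.isOpen_inter_preimage Metric.isOpen_ball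
    isOpen_compl_singleton
  have hVU : V ⊆ U := inter_subset_left.trans hrU
  have hu0 : ∀ q ∈ V, u q ≠ 0 := fun q hq => hq.2
  set σ : Plane 𝕜 → Plane 𝕜 →L[𝕜] 𝕜 := fun z => (u z)⁻¹ • φ z with hσdef
  have hσ : ContDiffOn 𝕜 n σ V :=
    ((huc.mono inter_subset_left).inv hu0).smul (hφ.mono hVU)
  have hσ' : ∀ q ∈ V, ∀ a b, fderiv 𝕜 σ q a b =
      σ q ((W.chern q + webTensor x y t q) a b) + σ q a * σ q b := by
    intro q hq a b
    have h1 := (hasDerivAt_inv (hu0 q hq)).comp_hasFDerivAt q (hu' q hq.1)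
    have h2 := (hφ.differentiableAt_of_infty_le hn hU (hVU hq)).hasFDerivAt
    have h3 : fderiv 𝕜 σ q = _ := (h1.smul h2).fderiv
    rw [h3]
    simp only [_root_.add_apply, ContinuousLinearMap.smulRight_apply, _root_.smul_apply,
      _root_.neg_apply, smul_eq_mul, Function.comp_apply, hpar q (hVU hq), hσdef, map_add]
    field_simp
  refine ⟨fun z => webTensor x y t z + symId (σ z), ⟨V, hVo, ⟨Metric.mem_ball_self hr, ?_⟩,
    hVU.trans hc.subset, ?_, ?_, ?_⟩, ?_⟩
  · simp [hup]
  · exact ((hc.contDiffOn_webTensor hn t).mono hVU).add (contDiffOn_symId hσ)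
  · exact fun q hq => hc.webTensor_add_symId_mem_E hn hD t _ (hVU hq)
  · intro q hq X Y Z
    have e : W.connection (fun z => webTensor x y t z + symId (σ z))
        = fun z => (W.chern z + webTensor x y t z) + symId (σ z) := by
      funext z
      exact ContinuousLinearMap.ext fun a => ContinuousLinearMap.ext fun b =>
        (add_assoc (W.chern z a b) _ _).symm
    rw [e, curvature_add_symId (hc.differentiableAt_chern_add hn hD t (hVU hq))
      (hσ.differentiableAt_of_infty_le hn hVo hq)
      (((((hc.contDiffOn_chern hn hD).add (hc.contDiffOn_webTensor hn t)).mono hVU).add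
        (contDiffOn_symId hσ)).differentiableAt_of_infty_le hn hVo hq)
      (hsymm q (hVU hq)) (hσ' q hq),
      hc.curvature_chern_add_webTensor hn hD t (hVU hq)]
  · simp [hσdef, hup, hφdef, expForm_self]

/-- At the points of a parallel chart, linearizations have arbitrary initial values, and
they are not all projectively equivalent. -/
theorem exists_linearizations (hn : ∞ ≤ n) (hD : IsOpen D) {p : Plane 𝕜} (hp : p ∈ U) :
    (∀ L₀ ∈ W.E p, ∃ L : Plane 𝕜 → Bilin2 𝕜, W.IsLinearizationGerm p L ∧ L p = L₀) ∧
    ∃ L L' : Plane 𝕜 → Bilin2 𝕜,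
      W.IsLinearizationGerm p L ∧ W.IsLinearizationGerm p L' ∧ ¬ W.ProjEquivGerm p L L' := by
  refine ⟨fun L₀ hL₀ => ?_, ?_⟩
  · obtain ⟨t, α, β, rfl⟩ := hc.exists_eq_of_mem_E hn hD hp hL₀
    exact hc.exists_linearization hn hD hp t α β
  -- The values at `p` are `webTensor 1` and `webTensor 0 = 0`; their difference is not of the form
  -- `symId η`.
  · obtain ⟨L, hL, hLp⟩ := hc.exists_linearization hn hD hp 1 0 0
    obtain ⟨L', hL', hLp'⟩ := hc.exists_linearization hn hD hp 0 0 0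
    refine ⟨L, L', hL, hL', ?_⟩
    rintro ⟨V, -, hpV, -, η, -, h⟩
    have hdet := hc.formDet_ne_zero hp
    have key : ∀ a b, fderiv 𝕜 x p a * fderiv 𝕜 x p b =
        η p a * fderiv 𝕜 x p b + η p b * fderiv 𝕜 x p a := by
      intro a b
      have := congrArg (fderiv 𝕜 x p) (h p hpV a b)
      simp [connection, hLp, hLp', hc.fst_webTensor _ hp] at this
      linear_combination this
    have key' : ∀ a b, -(fderiv 𝕜 y p a * fderiv 𝕜 y p b) =
        η p a * fderiv 𝕜 y p b + η p b * fderiv 𝕜 y p a := by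
      intro a b
      have := congrArg (fderiv 𝕜 y p) (h p hpV a b)
      simp [connection, hLp, hLp', hc.snd_webTensor _ hp] at this
      linear_combination this
    -- On `(e₁, e₁)` the first identity gives `1 = 2 η(e₁)`; on `(e₁, e₂)` the second gives `η(e₁) =
    -- 0`.
    have k1 := key (dualFst (fderiv 𝕜 x p) (fderiv 𝕜 y p)) (dualFst (fderiv 𝕜 x p) (fderiv 𝕜 y p))
    have k2 := key' (dualFst (fderiv 𝕜 x p) (fderiv 𝕜 y p))
      (dualSnd (fderiv 𝕜 x p) (fderiv 𝕜 y p))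
    simp only [fst_dualFst hdet, snd_dualFst, snd_dualSnd hdet] at k1 k2
    have : (1 : 𝕜) = 0 := by linear_combination k1 - 2 * k2
    exact one_ne_zero this

end IsParallelChart

end ThreeWeb

/-! ### Existence of parallel charts. -/

namespace ThreeWeb

variable {𝕜 : Type*} [RCLike 𝕜] {n : WithTop ℕ∞} {D : Set (Plane 𝕜)} (W : ThreeWeb 𝕜 n D)

/-- Near each point of `D`, a foliation of the web consists of the level lines of a function. -/
theorem exists_submersion (i : Fin 3) {q : Plane 𝕜} (hq : q ∈ D) :
    ∃ U : Set (Plane 𝕜), IsOpen U ∧ q ∈ U ∧ U ⊆ D ∧ ∃ f : Plane 𝕜 → 𝕜, ContDiffOn 𝕜 n f U ∧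
      ∀ z ∈ U, fderiv 𝕜 f z ≠ 0 ∧ ∀ a, a ∈ W.tang i z ↔ fderiv 𝕜 f z a = 0 := by
  obtain ⟨U, hU, hqU, hUD, f, hf, hf'⟩ := W.foliation i q hq
  refine ⟨U, hU, hqU, hUD, f, hf, fun z hz => ⟨(hf' z hz).1, fun a => ?_⟩⟩
  rw [(hf' z hz).2]
  rfl

theorem eq_zero_of_mem {i k : Fin 3} (hik : i ≠ k) {q : Plane 𝕜} (hq : q ∈ D) {a : Plane 𝕜}
    (hi : a ∈ W.tang i q) (hk : a ∈ W.tang k q) : a = 0 :=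
  Submodule.disjoint_def.1 (W.transversal i k hik q hq).disjoint a hi hk

/-- A coframe at a point of `D` that is adapted to the web. -/
theorem exists_coframe {q : Plane 𝕜} (hq : q ∈ D) : ∃ ξ η : Plane 𝕜 →L[𝕜] 𝕜, ∀ (i : Fin 3) a,
    a ∈ W.tang i q ↔ (![0, 1, 1] i : 𝕜) * ξ a + (![1, 0, 1] i : 𝕜) * η a = 0 := by
  have hex : ∀ i, ∃ α : Plane 𝕜 →L[𝕜] 𝕜, ∀ a, a ∈ W.tang i q ↔ α a = 0 := fun i => by
    obtain ⟨U, -, hqU, -, f, -, hf⟩ := W.exists_submersion i hq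
    exact ⟨_, (hf q hqU).2⟩
  choose α hα using hex
  have hdet : formDet (α 1) (α 0) ≠ 0 := formDet_ne_zero fun a h1 h0 =>
    W.eq_zero_of_mem (i := 0) (k := 1) (by decide) hq ((hα 0 a).2 h0) ((hα 1 a).2 h1)
  have h11 := fst_dualFst hdet
  have h22 := snd_dualSnd hdet
  have h12 : α 0 (dualFst (α 1) (α 0)) = 0 := snd_dualFst
  have h21 : α 1 (dualSnd (α 1) (α 0)) = 0 := fst_dualSnd
  set e₁ := dualFst (α 1) (α 0)
  set e₂ := dualSnd (α 1) (α 0)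
  have hdec : ∀ a, a = α 1 a • e₁ + α 0 a • e₂ := fun a =>
    coframe_ext hdet (by simp [h11, h21]) (by simp [h12, h22])
  have hc1 : α 2 e₁ ≠ 0 := fun h => by
    have := W.eq_zero_of_mem (i := 0) (k := 2) (by decide) hq ((hα 0 _).2 h12) ((hα 2 _).2 h)
    simp [this] at h11
  have hc2 : α 2 e₂ ≠ 0 := fun h => by
    have := W.eq_zero_of_mem (i := 1) (k := 2) (by decide) hq ((hα 1 _).2 h21) ((hα 2 _).2 h)
    simp [this] at h22
  have h2 : ∀ a, α 2 a = α 2 e₁ * α 1 a + α 2 e₂ * α 0 a := fun a => by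
    conv_lhs => rw [hdec a]
    simp [mul_comm]
  -- Rescaling the forms of the vertical and horizontal lines makes their sum the form of the
  -- transversal line. The factors are nonzero by transversality.
  refine ⟨α 2 e₁ • α 1, α 2 e₂ • α 0, fun i a => ?_⟩
  rw [hα i a]
  fin_cases i
  · simp [hc2]
  · simp [hc1]
  · simp [h2 a]

/-- A parallelizable web has parallel charts. -/
theorem IsParallelizable.exists_isParallelChart (hn : ∞ ≤ n) {W : ThreeWeb 𝕜 n D}
    (hW : W.IsParallelizable) {p : Plane 𝕜} (hp : p ∈ D) :
    ∃ U x y, p ∈ U ∧ W.IsParallelChart U x y := by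
  obtain ⟨φ, hpφ, hφD, hφ, hφ', ℓ, hℓ⟩ := hW p hp
  obtain ⟨ξ, η, hξη⟩ := W.exists_coframe hp
  have hd : ∀ q ∈ φ.source, DifferentiableAt 𝕜 φ q := fun q hq =>
    hφ.differentiableAt_of_infty_le hn φ.open_source hq
  have hd' : ∀ q ∈ φ.source, DifferentiableAt 𝕜 φ.symm (φ q) := fun q hq =>
    hφ'.differentiableAt_of_infty_le hn φ.open_target (φ.map_source hq)
  have hBA : ∀ q ∈ φ.source, ∀ a, fderiv 𝕜 φ.symm (φ q) (fderiv 𝕜 φ q a) = a := by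
    intro q hq a
    have h1 := ((hd' q hq).hasFDerivAt.comp q (hd q hq).hasFDerivAt).congr_of_eventuallyEq
      (f₁ := id) (by
        filter_upwards [φ.open_source.mem_nhds hq] with z hz
        exact (φ.left_inv hz).symm)
    have := h1.unique (hasFDerivAt_id q)
    exact congrArg (fun A : Plane 𝕜 →L[𝕜] Plane 𝕜 => A a) this
  have hAB : ∀ q ∈ φ.source, ∀ a, fderiv 𝕜 φ q (fderiv 𝕜 φ.symm (φ q) a) = a := by
    intro q hq a
    have h0 := (hd q hq).hasFDerivAt
    rw [← φ.left_inv hq] at h0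
    have h1 := (h0.comp (φ q) (hd' q hq).hasFDerivAt).congr_of_eventuallyEq
      (f₁ := id) (by
        filter_upwards [φ.open_target.mem_nhds (φ.map_source hq)] with z hz
        exact (φ.right_inv hz).symm)
    have := h1.unique (hasFDerivAt_id (φ q))
    rw [φ.left_inv hq] at this
    exact congrArg (fun A : Plane 𝕜 →L[𝕜] Plane 𝕜 => A a) this
  -- The inverse of `Dφ_p` carries the fixed direction `ℓ i` back to the tangent line at `p`, to
  -- which `ξ, η` are adapted. Hence `ξ ∘ B ∘ φ` and `η ∘ B ∘ φ` are the coordinates.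
  set B := fderiv 𝕜 φ.symm (φ p) with hB
  have hfd : ∀ (ζ : Plane 𝕜 →L[𝕜] 𝕜), ∀ q ∈ φ.source, ∀ a,
      fderiv 𝕜 (fun z => ζ (B (φ z))) q a = ζ (B (fderiv 𝕜 φ q a)) := by
    intro ζ q hq a
    have := ((ζ ∘L B).hasFDerivAt.comp q (hd q hq).hasFDerivAt).fderiv
    exact congrArg (fun A : Plane 𝕜 →L[𝕜] 𝕜 => A a) this
  have hsm : ∀ ζ : Plane 𝕜 →L[𝕜] 𝕜, ContDiffOn 𝕜 n (fun z => ζ (B (φ z))) φ.source := fun ζ =>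
    (ζ ∘L B).contDiff.comp_contDiffOn hφ
  refine ⟨φ.source, fun z => ξ (B (φ z)), fun z => η (B (φ z)), hpφ, φ.open_source, hφD, hsm ξ,
    hsm η, fun i q hq a => ?_⟩
  have h1 : webForm (fun z => ξ (B (φ z))) (fun z => η (B (φ z))) i q a
      = (![0, 1, 1] i : 𝕜) * ξ (B (fderiv 𝕜 φ q a))
        + (![1, 0, 1] i : 𝕜) * η (B (fderiv 𝕜 φ q a)) := by
    rw [← hfd ξ q hq, ← hfd η q hq]
    rfl
  rw [h1, ← hξη i]
  have h2 : a ∈ W.tang i q ↔ fderiv 𝕜 φ q a ∈ ℓ i := by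
    rw [← hℓ i q hq, Submodule.mem_map]
    refine ⟨fun h => ⟨a, h, rfl⟩, ?_⟩
    rintro ⟨b, hb, hba⟩
    have := congrArg (fderiv 𝕜 φ.symm (φ q)) hba
    rw [ContinuousLinearMap.coe_coe, hBA q hq, hBA q hq] at this
    rwa [← this]
  rw [h2, ← hℓ i p hpφ, Submodule.mem_map]
  constructor
  · rintro ⟨b, hb, hba⟩
    rw [← hba, ContinuousLinearMap.coe_coe, hB, hBA p hpφ]
    exact hb
  · intro h
    exact ⟨_, h, hAB p hpφ _⟩

/-! ### Regularity of the Chern connection -/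

theorem contDiffOn_projAlong (hn : ∞ ≤ n) {i k : Fin 3} (hik : i ≠ k) :
    ContDiffOn 𝕜 n (fun z => projAlong (W.tang i z) (W.tang k z)) D := by
  intro q hq
  refine ContDiffAt.contDiffWithinAt ?_
  obtain ⟨U, hU, hqU, hUD, f, hf, hf'⟩ := W.foliation i q hq
  obtain ⟨U', hU', hqU', -, g, hg, hg'⟩ := W.foliation k q hq
  have key : ∀ x ∈ U ∩ U', _ := fun x hx => projAlong_ker (α := fderiv 𝕜 f x) (β := fderiv 𝕜 g x)
    (by
      have := W.transversal i k hik x (hUD hx.1)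
      rwa [(hf' x hx.1).2, (hg' x hx.2).2] at this) (hf' x hx.1).1
  have hV := hU.inter hU'
  have df : ContDiffOn 𝕜 n (fderiv 𝕜 f) (U ∩ U') :=
    (hf.fderiv_of_infty_le hn hU).mono inter_subset_left
  have dg : ContDiffOn 𝕜 n (fderiv 𝕜 g) (U ∩ U') :=
    (hg.fderiv_of_infty_le hn hU').mono inter_subset_right
  have hX : ContDiffOn 𝕜 n
      (fun x => ((fderiv 𝕜 f x (0, 1), -fderiv 𝕜 f x (1, 0)) : Plane 𝕜)) (U ∩ U') :=
    (df.clm_apply contDiffOn_const).prodMk (df.clm_apply contDiffOn_const).neg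
  have hs := (((dg.clm_apply hX).inv fun x hx => (key x hx).1).smul dg).smulRight hX
  refine (hs.congr fun x hx => ?_).contDiffAt (hV.mem_nhds ⟨hqU, hqU'⟩)
  rw [(hf' x hx.1).2, (hg' x hx.2).2]
  exact (key x hx).2

theorem contDiffOn_h (hn : ∞ ≤ n) : ContDiffOn 𝕜 n W.h D :=
  W.contDiffOn_projAlong hn (by decide)

theorem contDiffOn_v (hn : ∞ ≤ n) : ContDiffOn 𝕜 n W.v D :=
  contDiffOn_const.sub (W.contDiffOn_h hn)

theorem contDiffOn_j (hn : ∞ ≤ n) : ContDiffOn 𝕜 n W.j D :=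
  ((W.contDiffOn_projAlong hn (by decide)).clm_comp (W.contDiffOn_h hn)).add
    ((W.contDiffOn_projAlong hn (by decide)).clm_comp (W.contDiffOn_v hn))

/-- This comes from the explicit formula rather than from a parallel chart, because in the flat case
it is needed to construct one. -/
theorem contDiffOn_chern (hn : ∞ ≤ n) (hD : IsOpen D) : ContDiffOn 𝕜 n W.chern D := by
  refine contDiffOn_clm_apply.2 fun a => contDiffOn_clm_apply.2 fun b => ?_
  simp only [W.chern_apply]
  have hh := W.contDiffOn_h hn
  have hv := W.contDiffOn_v hn
  have hj := W.contDiffOn_j hn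
  have dh := hh.fderiv_of_infty_le hn hD
  have dv := hv.fderiv_of_infty_le hn hD
  have dA := (hj.clm_comp hh).fderiv_of_infty_le hn hD
  have dB := (hj.clm_comp hv).fderiv_of_infty_le hn hD
  have ca : ContDiffOn 𝕜 n (fun _ : Plane 𝕜 => a) D := contDiffOn_const
  have cb : ContDiffOn 𝕜 n (fun _ : Plane 𝕜 => b) D := contDiffOn_const
  exact (((hv.clm_apply (((dv.clm_apply (hh.clm_apply ca)).clm_apply cb).sub
      ((dh.clm_apply (hv.clm_apply cb)).clm_apply ca))).add
    (hh.clm_apply (((dh.clm_apply (hv.clm_apply ca)).clm_apply cb).sub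
      ((dv.clm_apply (hh.clm_apply cb)).clm_apply ca)))).add
    (hj.clm_apply (hv.clm_apply (((dA.clm_apply (hh.clm_apply ca)).clm_apply cb).sub
      ((dh.clm_apply (hj.clm_apply (hh.clm_apply cb))).clm_apply ca))))).add
    (hj.clm_apply (hh.clm_apply (((dB.clm_apply (hv.clm_apply ca)).clm_apply cb).sub
      ((dv.clm_apply (hj.clm_apply (hv.clm_apply cb))).clm_apply ca))))

/-! ### The forms `df ∘ h` and `df ∘ v`

Here `f` is a function whose level lines are the transversal foliation. -/

/-- The 1-form `df ∘ h`. -/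
def hForm (f : Plane 𝕜 → 𝕜) (z : Plane 𝕜) : Plane 𝕜 →L[𝕜] 𝕜 := fderiv 𝕜 f z ∘L W.h z

/-- The 1-form `df ∘ v`. -/
def vForm (f : Plane 𝕜 → 𝕜) (z : Plane 𝕜) : Plane 𝕜 →L[𝕜] 𝕜 := fderiv 𝕜 f z ∘L W.v z

variable {W} {f : Plane 𝕜 → 𝕜} {q : Plane 𝕜}

theorem hForm_apply (a : Plane 𝕜) : W.hForm f q a = fderiv 𝕜 f q (W.h q a) := rfl

theorem vForm_apply (a : Plane 𝕜) : W.vForm f q a = fderiv 𝕜 f q (W.v q a) := rfl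

theorem hForm_add_vForm (a : Plane 𝕜) : W.hForm f q a + W.vForm f q a = fderiv 𝕜 f q a := by
  rw [hForm_apply, vForm_apply, ← map_add, W.v_apply]
  congr 1
  abel

section Pointwise

variable (hq : q ∈ D) (hf : ∀ a, a ∈ W.tang 2 q ↔ fderiv 𝕜 f q a = 0)
include hq

theorem hForm_h (a : Plane 𝕜) : W.hForm f q (W.h q a) = W.hForm f q a := by
  rw [hForm_apply, hForm_apply, W.h_h hq]

include hf

/-- A horizontal vector killed by `df` is also transversal, hence zero. -/
theorem hForm_eq_zero_iff (a : Plane 𝕜) : W.hForm f q a = 0 ↔ a ∈ W.tang 1 q := by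
  rw [← W.h_eq_zero_iff hq, hForm_apply, ← hf]
  refine ⟨fun h => W.eq_zero_of_mem (i := 0) (k := 2) (by decide) hq (W.h_mem hq a) h, fun h => ?_⟩
  rw [h]
  exact Submodule.zero_mem _

theorem vForm_eq_zero_iff (a : Plane 𝕜) : W.vForm f q a = 0 ↔ a ∈ W.tang 0 q := by
  rw [vForm_apply, ← hf]
  constructor
  · intro h
    have := W.eq_zero_of_mem (i := 1) (k := 2) (by decide) hq (W.v_mem hq a) h
    rw [W.v_apply, sub_eq_zero] at this
    rw [this]
    exact W.h_mem hq a
  · intro h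
    rw [W.v_apply, W.h_of_mem hq h, sub_self]
    exact Submodule.zero_mem _

/-- `hj = jv`, and `va - jva` is transversal, so `df` takes the same value on `va` and `jva`. -/
theorem hForm_j (a : Plane 𝕜) : W.hForm f q (W.j q a) = W.vForm f q a := by
  have h1 : W.h q (W.j q a) = W.j q (W.v q a) := by
    rw [W.h_j hq, ← map_sub, ← W.v_apply]
  have h2 := (hf _).1 (W.j_of_mem_one hq (W.v_mem hq a)).2
  rw [map_sub, sub_eq_zero] at h2
  rw [hForm_apply, h1, vForm_apply, h2]

theorem formDet_hForm_vForm_ne_zero : formDet (W.hForm f q) (W.vForm f q) ≠ 0 :=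
  formDet_ne_zero fun a h1 h2 => W.eq_zero_of_mem (i := 0) (k := 1) (by decide) hq
    ((vForm_eq_zero_iff hq hf a).1 h2) ((hForm_eq_zero_iff hq hf a).1 h1)

/-- The Chern connection is torsion-free. -/
theorem chern_comm (hn : ∞ ≤ n) (hD : IsOpen D) (a b : Plane 𝕜) :
    W.chern q a b = W.chern q b a := by
  obtain ⟨-, -, hT⟩ := W.chern_isChernAt (two_le_of_infty_le hn) hD hq
  have hdet := formDet_hForm_vForm_ne_zero hq hf
  have h11 := fst_dualFst hdet
  have h22 := snd_dualSnd hdet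
  have h12 : W.vForm f q (dualFst (W.hForm f q) (W.vForm f q)) = 0 := snd_dualFst
  have h21 : W.hForm f q (dualSnd (W.hForm f q) (W.vForm f q)) = 0 := fst_dualSnd
  set e₁ := dualFst (W.hForm f q) (W.vForm f q)
  set e₂ := dualSnd (W.hForm f q) (W.vForm f q)
  have hdec : ∀ a, a = W.hForm f q a • e₁ + W.vForm f q a • e₂ := fun a =>
    coframe_ext hdet (by simp [h11, h21]) (by simp [h12, h22])
  -- In dimension two the torsion is determined by its value at `(e₁, e₂)`. As `e₁` is horizontal
  -- and `e₂` vertical, the condition `T(hX, vY) = 0` applies.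
  have hT' := hT e₁ e₂
  rw [W.h_of_mem hq ((vForm_eq_zero_iff hq hf _).1 h12), W.v_apply,
    (W.h_eq_zero_iff hq _).2 ((hForm_eq_zero_iff hq hf _).1 h21), sub_zero, torsion,
    sub_eq_zero] at hT'
  rw [hdec a, hdec b]
  simp only [map_add, map_smul, _root_.add_apply, _root_.smul_apply, hT']
  module

end Pointwise

section Local

variable (hn : ∞ ≤ n) (hD : IsOpen D) {U : Set (Plane 𝕜)} (hU : IsOpen U) (hUD : U ⊆ D)
  (hfs : ContDiffOn 𝕜 n f U)
include hn hU hUD hfs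

theorem contDiffOn_hForm : ContDiffOn 𝕜 n (W.hForm f) U :=
  (hfs.fderiv_of_infty_le hn hU).clm_comp ((W.contDiffOn_h hn).mono hUD)

theorem contDiffOn_vForm : ContDiffOn 𝕜 n (W.vForm f) U :=
  (hfs.fderiv_of_infty_le hn hU).clm_comp ((W.contDiffOn_v hn).mono hUD)

variable (hf : ∀ z ∈ U, ∀ a, a ∈ W.tang 2 z ↔ fderiv 𝕜 f z a = 0) (hqU : q ∈ U)
include hD hf hqU

/-- The covariant derivative of `df ∘ h` is a multiple of it. -/
theorem fderiv_hForm (c a b : Plane 𝕜) (hc : W.hForm f q c ≠ 0) :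
    fderiv 𝕜 (W.hForm f) q a b = (W.hForm f q c)⁻¹ *
        (fderiv 𝕜 (W.hForm f) q a c - W.hForm f q (W.chern q a c)) * W.hForm f q b
      + W.hForm f q (W.chern q a b) := by
  have hq := hUD hqU
  have h2 := two_le_of_infty_le hn
  obtain ⟨hh, -, -⟩ := W.chern_isChernAt h2 hD hq
  have hd := (contDiffOn_hForm (W := W) hn hU hUD hfs).differentiableAt_of_infty_le hn hU hqU
  -- `N` is the covariant derivative of `φ = df ∘ h` along `a`. Since `h` is parallel and `φ ∘ h =
  -- φ`, also `N ∘ h = N`. So `N` vanishes on the vertical line, the kernel of `φ`, and is a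
  -- multiple of `φ`; evaluation at `c` gives the factor.
  set N : Plane 𝕜 →L[𝕜] 𝕜 := fderiv 𝕜 (W.hForm f) q a - W.hForm f q ∘L W.chern q a with hN
  have hNapp : ∀ b, N b = fderiv 𝕜 (W.hForm f) q a b - W.hForm f q (W.chern q a b) :=
    fun _ => rfl
  have hNh : ∀ b, N (W.h q b) = N b := by
    intro b
    have e1 := fderiv_form_comp hd (W.h_differentiableAt h2 hq)
      (mem_of_superset (hU.mem_nhds hqU) fun z hz => hForm_h (hUD hz)) a b
    have e2 := congrArg (W.hForm f q) (hh a b)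
    rw [covDerivEnd, map_sub, map_add, hForm_h hq, map_zero] at e2
    rw [hNapp, hNapp]
    linear_combination e1 - e2
  have hprop : W.h q b = ((W.hForm f q c)⁻¹ * W.hForm f q b) • W.h q c := by
    rw [← sub_eq_zero]
    refine W.eq_zero_of_mem (i := 0) (k := 1) (by decide) hq (Submodule.sub_mem _ (W.h_mem hq _)
      (Submodule.smul_mem _ _ (W.h_mem hq _))) ?_
    rw [← hForm_eq_zero_iff hq (hf q hqU), map_sub, map_smul, hForm_h hq, hForm_h hq, smul_eq_mul]
    field_simp
    simp
  have e : N b = (W.hForm f q c)⁻¹ * W.hForm f q b * N c := by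
    rw [← hNh b, hprop, map_smul, hNh, smul_eq_mul]
  rw [hNapp, hNapp] at e
  linear_combination e

/-- `df ∘ v` and `df ∘ h` have proportional covariant derivatives. -/
theorem fderiv_vForm (a b : Plane 𝕜) :
    fderiv 𝕜 (W.vForm f) q a b - W.vForm f q (W.chern q a b) =
      fderiv 𝕜 (W.hForm f) q a (W.j q b) - W.hForm f q (W.chern q a (W.j q b)) := by
  have hq := hUD hqU
  have h2 := two_le_of_infty_le hn
  obtain ⟨-, hj, -⟩ := W.chern_isChernAt h2 hD hq
  have hd := (contDiffOn_hForm (W := W) hn hU hUD hfs).differentiableAt_of_infty_le hn hU hqU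
  have e1 := fderiv_form_comp hd (W.j_differentiableAt h2 hq)
    (mem_of_superset (hU.mem_nhds hqU) fun z hz => hForm_j (hUD hz) (hf z hz)) a b
  have e2 := congrArg (W.hForm f q) (hj a b)
  rw [covDerivEnd, map_sub, map_add, hForm_j hq (hf q hqU), map_zero] at e2
  linear_combination e2 - e1

end Local

/-- A web with flat Chern connection has parallel charts. -/
theorem exists_isParallelChart_of_isFlatOn (hn : ∞ ≤ n) (hD : IsOpen D)
    (hW : IsFlatOn D W.chern) {p : Plane 𝕜} (hp : p ∈ D) :
    ∃ U x y, p ∈ U ∧ W.IsParallelChart U x y := by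
  obtain ⟨U₀, hU₀, hpU₀, hU₀D, f, hfs₀, hf₀⟩ := W.exists_submersion 2 hp
  have hdet := formDet_hForm_vForm_ne_zero hp (hf₀ p hpU₀).2
  set c := dualFst (W.hForm f p) (W.vForm f p) with hcdef
  have hcp : W.hForm f p c = 1 := fst_dualFst hdet
  -- shrink the neighbourhood so that the constant field `c` is not vertical
  set U := U₀ ∩ (fun z => W.hForm f z c) ⁻¹' {0}ᶜ with hUdef
  have hcont : ContDiffOn 𝕜 n (fun z => W.hForm f z c) U₀ :=
    (contDiffOn_hForm hn hU₀ hU₀D hfs₀).clm_apply contDiffOn_const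
  have hU : IsOpen U := hcont.continuousOn.isOpen_inter_preimage hU₀ isOpen_compl_singleton
  have hpU : p ∈ U := ⟨hpU₀, by simp [hcp]⟩
  have hUD : U ⊆ D := inter_subset_left.trans hU₀D
  have hfs : ContDiffOn 𝕜 n f U := hfs₀.mono inter_subset_left
  have hf : ∀ z ∈ U, ∀ a, a ∈ W.tang 2 z ↔ fderiv 𝕜 f z a = 0 := fun z hz => (hf₀ z hz.1).2
  have hc : ∀ z ∈ U, W.hForm f z c ≠ 0 := fun z hz => hz.2
  have h1s := contDiffOn_hForm (W := W) hn hU hUD hfs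
  have h2s := contDiffOn_vForm (W := W) hn hU hUD hfs
  have hΓ := (W.contDiffOn_chern hn hD).mono hUD
  -- the connection form of the line bundle of multiples of `df ∘ h`
  set l : Plane 𝕜 → Plane 𝕜 →L[𝕜] 𝕜 := fun z => (W.hForm f z c)⁻¹ •
    ((fderiv 𝕜 (W.hForm f) z).flip c - W.hForm f z ∘L (W.chern z).flip c) with hldef
  have hlapp : ∀ z a, l z a = (W.hForm f z c)⁻¹ *
      (fderiv 𝕜 (W.hForm f) z a c - W.hForm f z (W.chern z a c)) := fun _ _ => rfl
  have hls : ContDiffOn 𝕜 n l U := by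
    refine contDiffOn_clm_apply.2 fun a => ?_
    simp only [hlapp]
    exact ((h1s.clm_apply contDiffOn_const).inv hc).mul
      ((((h1s.fderiv_of_infty_le hn hU).clm_apply contDiffOn_const).clm_apply contDiffOn_const).sub
        (h1s.clm_apply ((hΓ.clm_apply contDiffOn_const).clm_apply contDiffOn_const)))
  have hpar1 : ∀ z ∈ U, ∀ a b, fderiv 𝕜 (W.hForm f) z a b =
      l z a * W.hForm f z b + W.hForm f z (W.chern z a b) := fun z hz a b => by
    rw [fderiv_hForm hn hD hU hUD hfs hf hz c a b (hc z hz), hlapp]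
  -- The same `l` works for `df ∘ v = df ∘ h ∘ j` because `j` is parallel.
  have hpar2 : ∀ z ∈ U, ∀ a b, fderiv 𝕜 (W.vForm f) z a b =
      l z a * W.vForm f z b + W.vForm f z (W.chern z a b) := fun z hz a b => by
    have := fderiv_vForm hn hD hU hUD hfs hf hz a b
    rw [hpar1 z hz, hForm_j (hUD hz) (hf z hz)] at this
    linear_combination this
  have hsymm : ∀ z ∈ U, ∀ a b, W.chern z a b = W.chern z b a := fun z hz =>
    chern_comm (hUD hz) (hf z hz) hn hD
  have hlcl : ∀ z ∈ U, ∀ a b, fderiv 𝕜 l z a b = fderiv 𝕜 l z b a := by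
    intro z hz a b
    -- Flatness gives `dl · φ(c) = 0` for `φ = df ∘ h`, and `φ(c)` does not vanish on `U`.
    have := form_curvature hn hU h1s hpar1 hz (hΓ.differentiableAt_of_infty_le hn hU hz)
      (hls.differentiableAt_of_infty_le hn hU hz) a b c
    rw [hW z (hUD hz), map_zero, eq_comm, neg_eq_zero, mul_eq_zero, sub_eq_zero] at this
    exact this.resolve_right (hc z hz)
  obtain ⟨r, hr, hrU, w, hw, hw'⟩ := exists_contDiffOn_hasFDerivAt_of_closed hn hU hpU hls hlcl
  have hexp : ContDiffOn 𝕜 n (fun z => NormedSpace.exp (-w z)) (Metric.ball p r) :=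
    contDiff_exp.comp_contDiffOn hw.neg
  -- rescaling by `e^{-w}` gives parallel, hence closed forms
  have hclosed : ∀ ψ : Plane 𝕜 → Plane 𝕜 →L[𝕜] 𝕜, ContDiffOn 𝕜 n ψ U →
      (∀ z ∈ U, ∀ a b, fderiv 𝕜 ψ z a b = l z a * ψ z b + ψ z (W.chern z a b)) →
      ∃ s > 0, Metric.ball p s ⊆ Metric.ball p r ∧ ∃ x : Plane 𝕜 → 𝕜,
        ContDiffOn 𝕜 n x (Metric.ball p s) ∧ ∀ z ∈ Metric.ball p s,
          HasFDerivAt x (NormedSpace.exp (-w z) • ψ z) z := by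
    intro ψ hψ hpar
    refine exists_contDiffOn_hasFDerivAt_of_closed hn Metric.isOpen_ball
      (Metric.mem_ball_self hr) (hexp.smul (hψ.mono hrU)) fun z hz => ?_
    have key : ∀ a b, fderiv 𝕜 (fun z => NormedSpace.exp (-w z) • ψ z) z a b =
        NormedSpace.exp (-w z) * ψ z (W.chern z a b) := by
      intro a b
      have e1 := (hasDerivAt_exp (x := -w z)).comp_hasFDerivAt z (hw' z hz).neg
      have e2 := (hψ.differentiableAt_of_infty_le hn hU (hrU hz)).hasFDerivAt
      have e3 := (e1.smul e2).fderiv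
      change fderiv 𝕜 (fun z => NormedSpace.exp (-w z) • ψ z) z = _ at e3
      rw [e3]
      simp [hpar z (hrU hz)]
      ring
    intro a b
    rw [key, key, hsymm z (hrU hz)]
  obtain ⟨s, hs, hsr, x, hx, hx'⟩ := hclosed _ h1s hpar1
  obtain ⟨s', hs', hsr', y, hy, hy'⟩ := hclosed _ h2s hpar2
  refine ⟨Metric.ball p s ∩ Metric.ball p s', x, y,
    ⟨Metric.mem_ball_self hs, Metric.mem_ball_self hs'⟩,
    Metric.isOpen_ball.inter Metric.isOpen_ball,
    inter_subset_left.trans (hsr.trans (hrU.trans hUD)), hx.mono inter_subset_left,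
    hy.mono inter_subset_right, fun i z hz a => ?_⟩
  have hzU : z ∈ U := hrU (hsr hz.1)
  have hzD := hUD hzU
  -- Both forms carry the same factor `e^{-w}`, so `d(x + y) = e^{-w} df` and the level lines of `x
  -- + y` are the transversal leaves.
  have e : webForm x y i z a = NormedSpace.exp (-w z) *
      ((![0, 1, 1] i : 𝕜) * W.hForm f z a + (![1, 0, 1] i : 𝕜) * W.vForm f z a) := by
    rw [webForm, (hx' z hz.1).fderiv, (hy' z hz.2).fderiv]
    simp only [_root_.add_apply, _root_.smul_apply, smul_eq_mul]
    ring
  rw [e, mul_eq_zero, or_iff_right (exp_ne_zero _)]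
  fin_cases i
  · simp [vForm_eq_zero_iff hzD (hf z hzU)]
  · simp [hForm_eq_zero_iff hzD (hf z hzU)]
  · simp [hForm_add_vForm, hf z hzU]

end ThreeWeb

end

theorem mainTheorem3 {𝕜 : Type*} [RCLike 𝕜] (n : WithTop ℕ∞) (hn : ∞ ≤ n)
    (D : Set (Plane 𝕜)) (hD : IsOpen D) (W : ThreeWeb 𝕜 n D)
    (hW : W.IsParallelizable ∨ IsFlatOn D W.chern) (p : Plane 𝕜) (hp : p ∈ D) :
    (∀ L₀ ∈ W.E p, ∃ L : Plane 𝕜 → Bilin2 𝕜, W.IsLinearizationGerm p L ∧ L p = L₀) ∧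
    ∃ L L' : Plane 𝕜 → Bilin2 𝕜,
      W.IsLinearizationGerm p L ∧ W.IsLinearizationGerm p L' ∧ ¬ W.ProjEquivGerm p L L' := by
  obtain ⟨U, x, y, hpU, hc⟩ : ∃ U x y, p ∈ U ∧ W.IsParallelChart U x y :=
    hW.elim (fun h => h.exists_isParallelChart hn hp)
      fun h => ThreeWeb.exists_isParallelChart_of_isFlatOn hn hD h hp
  exact hc.exists_linearizations hn hD hpU
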